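/- Let $f:\mathbb{R}^n\to\mathbb{R}$ be convex, let $x\in\mathbb{R}^n$, and let $\mathcal{D}=\{h: f(x+h)\le f(x)\}$ be the descent set of $f$ at $x$. A cone of descent is a closed cone containing $\mathcal{D}$; the tangent cone $T$ is the smallest one. Let $\mathcal{C}$ be any cone of descent (for instance $\mathcal{C}=T$), let $\omega=\mathbb{E}\big[\sup_{v\in\mathcal{C},\,\|v\|\le 1}\langle g,v\rangle\big]$ with $g\sim\mathcal{N}(0,I_n)$, let $\eta\ge 0$, and let $m_0=\phi^{-1}(\omega+\eta)$, where $\phi(t)=\sqrt{2}\,\Gamma(\frac{t+1}{2})/\Gamma(\frac t2)$ on $[0,\infty)$ (with $\phi(0)=0$). Let $A\in\mathbb{R}^{m\times n}$ have independent $\mathcal{N}(0,1)$ entries, let $y=Ax$, let $\mu>0$, and consider projected gradient descent $$z_{\tau+1}=\mathcal{P}_{\mathcal{K}}\big(z_\tau+\mu A^{*}(y-Az_\tau)\big),\qquad \mathcal{K}=\{z: f(z)\le f(x)\},$$ where $\mathcal{P}_{\mathcal{K}}$ is the Euclidean projection onto $\mathcal{K}$. For every $\varepsilon\in(0,1]$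 there is a deterministic radius $r(\varepsilon)>0$ such that, with probability at least $1-e^{-\eta^2/2}$, simultaneously for all starting points $z_0$ with $\|z_0-x\|\le r(\varepsilon)$ and $z_0-x\in T$ (in particular for all such $z_0\in\mathcal{K}$) and for all $\tau\ge 0$, $$\|z_\tau-x\|\ \ge\ (1-\varepsilon)^\tau\,\max\!\big(1-\mu(\sqrt m+\sqrt{m_0})^2,\,0\big)^\tau\,\|z_0-x\|.$$ In particular, on the same event, if $m\ge m_0$ and $\mu\le c/n$, then $\|z_\tau-x\|\ge(1-\varepsilon)^\tau\max\big(1-4c\,\tfrac mn,\,0\big)^\tau\|z_0-x\|$, so a step size of order $1/n$ cannot give a rate faster than $1-O(m/n)$. (The conservative step $\mu=0.99/(\sqrt m+\sqrt n)^2$ is one admissible choice of $\mu$.) -/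

import Mathlib

open MeasureTheory ProbabilityTheory

namespace PGD

noncomputable section

/-- The descent set of `f` at `x`. -/
def descentSet {n : ℕ} (f : EuclideanSpace ℝ (Fin n) → ℝ) (x : EuclideanSpace ℝ (Fin n)) :
    Set (EuclideanSpace ℝ (Fin n)) :=
  {h | f (x + h) ≤ f x}

/-- `C` is a cone of descent of `f` at `x`: a closed cone (not necessarily convex) which contains
the descent set. -/
structure IsDescentCone {n : ℕ} (f : EuclideanSpace ℝ (Fin n) → ℝ)
    (x : EuclideanSpace ℝ (Fin n)) (C : Set (EuclideanSpace ℝ (Fin n))) : Prop where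
  isClosed : IsClosed C
  smul_mem : ∀ t : ℝ, 0 < t → ∀ v ∈ C, t • v ∈ C
  descentSet_subset : descentSet f x ⊆ C

/-- The tangent cone of `f` at `x`: the smallest closed cone containing the descent set. -/
def tangentCone {n : ℕ} (f : EuclideanSpace ℝ (Fin n) → ℝ) (x : EuclideanSpace ℝ (Fin n)) :
    Set (EuclideanSpace ℝ (Fin n)) :=
  ⋂₀ {C | IsDescentCone f x C}

/-- The Gaussian width `E [sup_{z ∈ S} ⟨g, z⟩]`, with `g` a standard Gaussian vector. -/
def gaussianWidth {n : ℕ} (S : Set (EuclideanSpace ℝ (Fin n))) : ℝ :=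
  ∫ g, sSup ((fun z => inner ℝ g z) '' S) ∂(stdGaussian (EuclideanSpace ℝ (Fin n)))

/-- `φ(t) = √2 Γ((t+1)/2) / Γ(t/2)`; at `t = 0`, where `Γ` has a pole, this is the limit `0`. -/
def phi (t : ℝ) : ℝ :=
  √2 * Real.Gamma ((t + 1) / 2) / Real.Gamma (t / 2)

/-- The phase transition function `φ⁻¹(ω(C ∩ B) + η)`, where `C` is a cone of descent, `B` is the
closed unit ball and `φ⁻¹` is the inverse of `φ : [0, ∞) → [0, ∞)`. -/
def phaseTransition {n : ℕ} (C : Set (EuclideanSpace ℝ (Fin n))) (η : ℝ) : ℝ :=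
  Function.invFunOn phi (Set.Ici 0) (gaussianWidth (C ∩ Metric.closedBall 0 1) + η)

/-- A random `m × n` matrix with independent standard normal entries. -/
structure IsGaussianMap {Ω : Type*} [MeasurableSpace Ω] {m n : ℕ}
    (A : Ω → Matrix (Fin m) (Fin n) ℝ) (P : Measure Ω) : Prop where
  hasLaw : ∀ i j, HasLaw (fun ω => A ω i j) (gaussianReal 0 1) P
  indep : iIndepFun (fun (p : Fin m × Fin n) ω => A ω p.1 p.2) P

/-- `p` is a Euclidean projection of `v` onto `K`. -/
def IsProj {n : ℕ} (K : Set (EuclideanSpace ℝ (Fin n))) (v p : EuclideanSpace ℝ (Fin n)) : Prop :=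
  p ∈ K ∧ ∀ q ∈ K, ‖v - p‖ ≤ ‖v - q‖

/-- `z` is a run of projected gradient descent,
`z (τ + 1) = P_K (z τ + μ Aᵀ (y - A z τ))`, from the initial point `z 0`. -/
def IsPGD {m n : ℕ} (K : Set (EuclideanSpace ℝ (Fin n))) (A : Matrix (Fin m) (Fin n) ℝ)
    (y : EuclideanSpace ℝ (Fin m)) (μ : ℝ) (z : ℕ → EuclideanSpace ℝ (Fin n)) : Prop :=
  ∀ τ : ℕ, IsProj K
    (z τ + μ • Matrix.toEuclideanLin A.transpose (y - Matrix.toEuclideanLin A (z τ))) (z (τ + 1))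

end

end PGD

namespace PGD

/-! Put `h = z τ - x` and `κ = √m + √m₀`. The shifted next iterate is the projection of `u = h - μ
AᵀA h` onto the descent set. If `‖A v‖ ≤ κ` for every unit `v` in the tangent cone, then `⟨u, h⟩ ≥ ρ
‖h‖²` with `ρ = 1 - μ κ²`, so `u` has slope at least `ρ ‖h‖` in some tangent direction. Projecting
onto the tangent cone itself would give a point of norm equal to the maximal slope. The descent set
is only part of that cone, but it fills it near the origin up to a relative error `δ`, uniformly in
the direction (`exists_radius_descentSet_approx`: convexity and compactness of the unit sphere). A
quantitative projection estimate (`one_sub_mul_le_norm_of_inner_le_zero`) turns this into a loss of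
a factor `1 - ε`, and the step bound iterates (`exists_radius_pow_mul_le`).

The probabilistic input is that `‖A v‖ ≤ √m + ω + t` on the unit vectors of `C` outside an event of
probability at most `exp (-t²/2)` (`measureReal_compl_boundedOn_le`). Chevet's comparison of `⟨A u,
v⟩` with `⟨h, v⟩ + ⟨g, u⟩` and the concentration are obtained together, by one interpolation for
exponential moments (`integral_exp_softMax_le_pow`). There `N` identical copies of the first process
are compared with `N` independent copies of the second; as `N → ∞` the latter enters only through
its mean, and Chernoff's bound finishes.

The radius must not depend on `A`, while the admissible `δ` depends on a bound for `AᵀA`. For `η >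
0` the strict inequality `ω + η < √m₀` (`lt_sqrt_invFunOn_phi`) leaves spare probability, which pays
for restricting to a large ball of matrices (`exists_norm_bound`). -/

/-! ### Gaussian integration by parts. -/

/-- The standard Gaussian measure on `κ → ℝ`. -/
noncomputable abbrev gaussianPi (κ : Type*) [Fintype κ] : Measure (κ → ℝ) :=
  Measure.pi fun _ => gaussianReal 0 1

theorem hasDerivAt_gaussianPDFReal (t : ℝ) :
    HasDerivAt (gaussianPDFReal 0 1) (-(t * gaussianPDFReal 0 1 t)) t := by
  have h : HasDerivAt (fun t : ℝ => (√(2 * Real.pi * (1 : NNReal)))⁻¹ *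
      Real.exp (-(t - 0) ^ 2 / (2 * (1 : NNReal))))
      ((√(2 * Real.pi * (1 : NNReal)))⁻¹ * (Real.exp (-(t - 0) ^ 2 / (2 * (1 : NNReal))) *
        (-(2 * (t - 0)) / (2 * (1 : NNReal))))) t := by
    have h1 : HasDerivAt (fun t : ℝ => -(t - 0) ^ 2 / (2 * ((1 : NNReal) : ℝ)))
        (-(2 * (t - 0)) / (2 * (1 : NNReal))) t := by
      have := (((hasDerivAt_id t).sub_const 0).pow 2).neg.div_const (2 * ((1 : NNReal) : ℝ))
      simpa using this
    exact h1.exp.const_mul _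
  refine HasDerivAt.congr_deriv (f := gaussianPDFReal 0 1) h ?_
  simp only [gaussianPDFReal, NNReal.coe_one]
  ring

theorem integrable_gaussianReal_iff {f : ℝ → ℝ} :
    Integrable f (gaussianReal 0 1) ↔ Integrable (fun t => f t * gaussianPDFReal 0 1 t) := by
  rw [gaussianReal_of_var_ne_zero _ one_ne_zero,
    integrable_withDensity_iff (measurable_gaussianPDF _ _)
      (ae_of_all _ fun _ => gaussianPDF_lt_top)]
  simp [toReal_gaussianPDF]

/-- Stein's identity on the real line. -/
theorem integral_id_mul_gaussianReal {f f' : ℝ → ℝ} (hf : ∀ t, HasDerivAt f (f' t) t)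
    (h0 : Integrable f (gaussianReal 0 1)) (h1 : Integrable f' (gaussianReal 0 1))
    (h2 : Integrable (fun t => t * f t) (gaussianReal 0 1)) :
    ∫ t, t * f t ∂(gaussianReal 0 1) = ∫ t, f' t ∂(gaussianReal 0 1) := by
  rw [integrable_gaussianReal_iff] at h0 h1 h2
  have key := integral_mul_deriv_eq_deriv_mul_of_integrable (u := f) (u' := f')
    (v := gaussianPDFReal 0 1) (v' := fun t => -(t * gaussianPDFReal 0 1 t))
    (fun t _ => hf t) (fun t _ => hasDerivAt_gaussianPDFReal t)
    (by
      refine h2.neg.congr (ae_of_all _ fun t => ?_)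
      simp only [Pi.neg_apply, Pi.mul_apply]; ring)
    h1 h0
  rw [integral_gaussianReal_eq_integral_smul one_ne_zero,
    integral_gaussianReal_eq_integral_smul one_ne_zero]
  simp only [smul_eq_mul]
  have e1 : ∫ t, gaussianPDFReal 0 1 t * (t * f t) =
      -∫ t, f t * -(t * gaussianPDFReal 0 1 t) := by
    rw [← integral_neg]; congr 1; ext t; ring
  rw [e1, key, neg_neg]
  congr 1; ext t; ring

/-- Resampling one coordinate preserves the standard Gaussian measure. -/
theorem measurePreserving_update {κ : Type*} [Fintype κ] [DecidableEq κ] (k : κ) :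
    MeasurePreserving (fun p : (κ → ℝ) × ℝ => Function.update p.1 k p.2)
      ((gaussianPi κ).prod (gaussianReal 0 1)) (gaussianPi κ) := by
  have hm : Measurable (fun p : (κ → ℝ) × ℝ => Function.update p.1 k p.2) := by
    refine measurable_pi_lambda _ fun i => ?_
    by_cases h : i = k
    · subst h; simpa using measurable_snd
    · simp only [Function.update_of_ne h]; fun_prop
  refine ⟨hm, ?_⟩
  symm
  refine Measure.pi_eq fun s hs => ?_
  rw [Measure.map_apply hm (MeasurableSet.univ_pi hs)]
  have e : (fun p : (κ → ℝ) × ℝ => Function.update p.1 k p.2) ⁻¹' Set.pi Set.univ s =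
      (Set.pi Set.univ (Function.update s k Set.univ)) ×ˢ s k := by
    ext p
    simp only [Set.mem_preimage, Set.mem_pi, Set.mem_univ, true_imp_iff, Set.mem_prod]
    constructor
    · intro h
      refine ⟨fun i => ?_, by simpa using h k⟩
      by_cases hi : i = k
      · subst hi; simp
      · simpa [Function.update_of_ne hi] using h i
    · rintro ⟨h, h'⟩ i
      by_cases hi : i = k
      · subst hi; simpa using h'
      · simpa [Function.update_of_ne hi] using h i
  rw [e, Measure.prod_prod, Measure.pi_pi, ← Finset.mul_prod_erase _ _ (Finset.mem_univ k),
    ← Finset.mul_prod_erase (a := k) (f := fun i => gaussianReal 0 1 (s i)) _ (Finset.mem_univ k)]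
  have : ∀ i ∈ Finset.univ.erase k, gaussianReal 0 1 (Function.update s k Set.univ i) =
      gaussianReal 0 1 (s i) := by
    intro i hi
    rw [Function.update_of_ne (Finset.ne_of_mem_erase hi)]
  rw [Finset.prod_congr rfl this]
  simp [mul_comm]

/-- Gaussian integration by parts in one coordinate. -/
theorem integral_coord_mul_gaussianPi {κ : Type*} [Fintype κ] [DecidableEq κ] (k : κ)
    {f f' : (κ → ℝ) → ℝ}
    (hf : ∀ x t, HasDerivAt (fun s => f (Function.update x k s)) (f' (Function.update x k t)) t)
    (h0 : Integrable f (gaussianPi κ)) (h1 : Integrable f' (gaussianPi κ))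
    (h2 : Integrable (fun x => x k * f x) (gaussianPi κ)) :
    ∫ x, x k * f x ∂(gaussianPi κ) = ∫ x, f' x ∂(gaussianPi κ) := by
  have mp := measurePreserving_update k
  -- Resampling coordinate `k` and applying Fubini isolates a one-dimensional Gaussian integral, to
  -- which Stein's identity applies for almost every value of the other coordinates.
  have key : ∀ {g : (κ → ℝ) → ℝ}, Integrable g (gaussianPi κ) →
      ∫ x, g x ∂(gaussianPi κ) =
        ∫ x, ∫ t, g (Function.update x k t) ∂(gaussianReal 0 1) ∂(gaussianPi κ) := by
    intro g hg
    have hg' := mp.integrable_comp_of_integrable hg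
    have h := integral_prod _ hg'
    simp only [Function.comp_def] at h
    rw [← h]
    conv_lhs => rw [← mp.map_eq]
    exact integral_map mp.measurable.aemeasurable (by rw [mp.map_eq]; exact hg.aestronglyMeasurable)
  rw [key h2, key h1]
  refine integral_congr_ae ?_
  filter_upwards [(mp.integrable_comp_of_integrable h0).prod_right_ae,
    (mp.integrable_comp_of_integrable h1).prod_right_ae,
    (mp.integrable_comp_of_integrable h2).prod_right_ae] with x i0 i1 i2
  simp only [Function.comp_def, Function.update_self] at i0 i1 i2 ⊢
  exact integral_id_mul_gaussianReal (hf x) i0 i1 i2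

/-- `exp (K ∑ |x_k|)` is integrable for the standard Gaussian measure. -/
theorem integrable_exp_sum_abs {κ : Type*} [Fintype κ] (K : ℝ) :
    Integrable (fun x : κ → ℝ => Real.exp (K * ∑ k, |x k|)) (gaussianPi κ) := by
  have h1 : Integrable (fun t : ℝ => Real.exp (K * |t|)) (gaussianReal 0 1) := by
    refine ((integrable_exp_mul_gaussianReal (μ := 0) (v := 1) K).add
      (integrable_exp_mul_gaussianReal (μ := 0) (v := 1) (-K))).mono' (by fun_prop)
      (ae_of_all _ fun t => ?_)
    simp only [Real.norm_eq_abs, Real.abs_exp, Pi.add_apply]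
    rcases abs_cases t with ⟨h, _⟩ | ⟨h, _⟩ <;> rw [h]
    · linarith [Real.exp_pos (-K * t)]
    · have : K * -t = -K * t := by ring
      rw [this]; linarith [Real.exp_pos (K * t)]
  have := Integrable.fintype_prod (μ := fun _ : κ => gaussianReal 0 1) (fun _ => h1)
  refine this.congr (ae_of_all _ fun x => ?_)
  simp only [← Real.exp_sum, Finset.mul_sum]

/-! ### Exponential growth and Gaussian interpolation. -/

/-- The linear forms with coefficient vectors `c j`. -/
def linForms {J κ : Type*} [Fintype κ] (c : J → κ → ℝ) (x : κ → ℝ) (j : J) : ℝ :=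
  ∑ k, c j k * x k

/-- `Φ' j` are the partial derivatives of `Φ`, in the form of a chain rule along curves. -/
def HasPartials {J : Type*} [Fintype J] (Φ : (J → ℝ) → ℝ) (Φ' : J → (J → ℝ) → ℝ) : Prop :=
  ∀ (z : ℝ → J → ℝ) (z' : J → ℝ) (t : ℝ), (∀ j, HasDerivAt (fun s => z s j) (z' j) t) →
    HasDerivAt (fun s => Φ (z s)) (∑ j, Φ' j (z t) * z' j) t

/-- `Φ` grows at most exponentially. -/
def ExpGrowth {J : Type*} [Fintype J] (Φ : (J → ℝ) → ℝ) : Prop :=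
  ∃ K : ℝ, 0 ≤ K ∧ ∀ z, |Φ z| ≤ K * Real.exp (K * ∑ j, |z j|)

theorem continuous_linForms {J κ : Type*} [Fintype κ] (c : J → κ → ℝ) : Continuous (linForms c) := by
  refine continuous_pi fun j => ?_
  unfold linForms
  fun_prop

section
variable {J κ : Type*} [Fintype J] [Fintype κ]

theorem sum_abs_linForms_le (c : J → κ → ℝ) (x : κ → ℝ) :
    ∑ j, |linForms c x j| ≤ (∑ j, ∑ k, |c j k|) * ∑ k, |x k| := by
  rw [Finset.sum_mul]
  refine Finset.sum_le_sum fun j _ => ?_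
  refine (Finset.abs_sum_le_sum_abs _ _).trans ?_
  rw [Finset.sum_mul]
  refine Finset.sum_le_sum fun k _ => ?_
  rw [abs_mul]
  exact mul_le_mul_of_nonneg_left
    (Finset.single_le_sum (f := fun k => |x k|) (fun _ _ => abs_nonneg _) (Finset.mem_univ k))
    (abs_nonneg _)

theorem abs_linForms_le (c : J → κ → ℝ) (x : κ → ℝ) (j : J) :
    |linForms c x j| ≤ (∑ j, ∑ k, |c j k|) * ∑ k, |x k| :=
  (Finset.single_le_sum (f := fun j => |linForms c x j|) (fun _ _ => abs_nonneg _)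
    (Finset.mem_univ j)).trans (sum_abs_linForms_le c x)

/-- Gaussian tails beat every exponential. Since exponential growth also survives products and
linear substitutions, it handles integrability throughout the interpolation. -/
theorem ExpGrowth.integrable {Φ : (κ → ℝ) → ℝ} (h : ExpGrowth Φ) (hc : Continuous Φ) :
    Integrable Φ (gaussianPi κ) := by
  obtain ⟨K, -, hK⟩ := h
  exact ((integrable_exp_sum_abs K).const_mul K).mono' hc.aestronglyMeasurable
    (ae_of_all _ fun x => by simpa using hK x)

theorem ExpGrowth.comp_linForms {Φ : (J → ℝ) → ℝ} (h : ExpGrowth Φ) (c : J → κ → ℝ) :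
    ExpGrowth (fun x => Φ (linForms c x)) := by
  obtain ⟨K, hK0, hK⟩ := h
  set M := ∑ j, ∑ k, |c j k| with hM
  have hM0 : 0 ≤ M := Finset.sum_nonneg fun j _ => Finset.sum_nonneg fun k _ => abs_nonneg _
  refine ⟨K * M + K, by positivity, fun x => (hK _).trans ?_⟩
  have hS : 0 ≤ ∑ k, |x k| := Finset.sum_nonneg fun k _ => abs_nonneg _
  have := sum_abs_linForms_le c x
  have h1 : K * ∑ j, |linForms c x j| ≤ (K * M + K) * ∑ k, |x k| := by
    calc K * ∑ j, |linForms c x j| ≤ K * (M * ∑ k, |x k|) := by gcongr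
      _ ≤ _ := by nlinarith [mul_nonneg hK0 hS]
  have h2 : K ≤ K * M + K := by nlinarith
  gcongr

theorem ExpGrowth.mul {Φ Ψ : (J → ℝ) → ℝ} (h : ExpGrowth Φ) (h' : ExpGrowth Ψ) :
    ExpGrowth (fun x => Φ x * Ψ x) := by
  obtain ⟨K, hK0, hK⟩ := h
  obtain ⟨L, hL0, hL⟩ := h'
  refine ⟨K * L + (K + L), by positivity, fun x => ?_⟩
  have hS : 0 ≤ ∑ k, |x k| := Finset.sum_nonneg fun k _ => abs_nonneg _
  rw [abs_mul]
  calc |Φ x| * |Ψ x| ≤ (K * Real.exp (K * ∑ j, |x j|)) * (L * Real.exp (L * ∑ j, |x j|)) :=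
        mul_le_mul (hK x) (hL x) (abs_nonneg _) (by positivity)
    _ = (K * L) * Real.exp ((K + L) * ∑ j, |x j|) := by rw [add_mul, Real.exp_add]; ring
    _ ≤ _ := by
        have hKL : 0 ≤ K * L := by positivity
        have e₁ : K * L ≤ K * L + (K + L) := by linarith
        have e₂ : K + L ≤ K * L + (K + L) := by linarith
        exact mul_le_mul e₁ (Real.exp_le_exp.2 (mul_le_mul_of_nonneg_right e₂ hS))
          (Real.exp_pos _).le (by positivity)

theorem ExpGrowth.of_abs_le {Φ Ψ : (J → ℝ) → ℝ} (h : ExpGrowth Φ) (h' : ∀ x, |Ψ x| ≤ |Φ x|) :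
    ExpGrowth Ψ := by
  obtain ⟨K, hK0, hK⟩ := h
  exact ⟨K, hK0, fun x => (h' x).trans (hK x)⟩

theorem expGrowth_const (C : ℝ) : ExpGrowth (fun _ : J → ℝ => C) := by
  refine ⟨|C|, abs_nonneg _, fun z => ?_⟩
  have : 0 ≤ ∑ j, |z j| := Finset.sum_nonneg fun _ _ => abs_nonneg _
  nlinarith [Real.one_le_exp (mul_nonneg (abs_nonneg C) this), abs_nonneg C]

theorem expGrowth_coord (k : J) : ExpGrowth (fun x : J → ℝ => x k) := by
  refine ⟨1, zero_le_one, fun x => ?_⟩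
  have := Finset.single_le_sum (f := fun k => |x k|) (fun _ _ => abs_nonneg _) (Finset.mem_univ k)
  rw [one_mul, one_mul]
  exact this.trans ((le_add_of_nonneg_right zero_le_one).trans (Real.add_one_le_exp _))

theorem HasPartials.hasDerivAt_update {Φ : (J → ℝ) → ℝ} {Φ' : J → (J → ℝ) → ℝ}
    (h : HasPartials Φ Φ') (c : J → κ → ℝ) [DecidableEq κ] (k : κ) (x : κ → ℝ) (t : ℝ) :
    HasDerivAt (fun s => Φ (linForms c (Function.update x k s)))
      (∑ j, Φ' j (linForms c (Function.update x k t)) * c j k) t := by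
  refine h (fun s => linForms c (Function.update x k s)) (fun j => c j k) t fun j => ?_
  unfold linForms
  have : ∀ i ∈ Finset.univ, HasDerivAt (fun s => c j i * Function.update x k s i)
      (if i = k then c j i else 0) t := by
    intro i _
    by_cases hi : i = k
    · subst hi
      simpa using (hasDerivAt_id t).const_mul (c j i)
    · simpa [hi] using hasDerivAt_const t (c j i * x i)
  simpa using HasDerivAt.fun_sum this

/-- **Gaussian interpolation**: derivative of `E Φ(⟨cos θ a_j + sin θ b_j, g⟩)`. -/
theorem hasDerivAt_integral_interpolation {Φ : (J → ℝ) → ℝ} {Φ₁ : J → (J → ℝ) → ℝ}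
    {Φ₂ : J → J → (J → ℝ) → ℝ} (h₁ : HasPartials Φ Φ₁) (h₂ : ∀ i, HasPartials (Φ₁ i) (Φ₂ i))
    (c₀ : Continuous Φ) (c₁ : ∀ i, Continuous (Φ₁ i)) (c₂ : ∀ i j, Continuous (Φ₂ i j))
    (g₀ : ExpGrowth Φ) (g₁ : ∀ i, ExpGrowth (Φ₁ i)) (g₂ : ∀ i j, ExpGrowth (Φ₂ i j))
    (a b : J → κ → ℝ) (θ : ℝ) :
    HasDerivAt (fun θ => ∫ x, Φ (linForms (fun j k => Real.cos θ * a j k + Real.sin θ * b j k) x)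
        ∂(gaussianPi κ))
      (∫ x, ∑ i, ∑ j, (∑ k, (-Real.sin θ * a i k + Real.cos θ * b i k) *
          (Real.cos θ * a j k + Real.sin θ * b j k)) *
          Φ₂ i j (linForms (fun j k => Real.cos θ * a j k + Real.sin θ * b j k) x)
        ∂(gaussianPi κ)) θ := by
  classical
  set c : ℝ → J → κ → ℝ := fun θ j k => Real.cos θ * a j k + Real.sin θ * b j k with hc
  set c' : ℝ → J → κ → ℝ := fun θ j k => -Real.sin θ * a j k + Real.cos θ * b j k with hc'
  set M := ∑ j, ∑ k, (|a j k| + |b j k|) with hM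
  have hM0 : 0 ≤ M := Finset.sum_nonneg fun j _ => Finset.sum_nonneg fun k _ => by positivity
  have hcM : ∀ θ, ∑ j, ∑ k, |c θ j k| ≤ M := by
    intro θ
    refine Finset.sum_le_sum fun j _ => Finset.sum_le_sum fun k _ => ?_
    refine (abs_add_le _ _).trans (add_le_add ?_ ?_) <;> rw [abs_mul]
    · exact mul_le_of_le_one_left (abs_nonneg _) (Real.abs_cos_le_one θ)
    · exact mul_le_of_le_one_left (abs_nonneg _) (Real.abs_sin_le_one θ)
  have hcM' : ∀ θ, ∑ j, ∑ k, |c' θ j k| ≤ M := by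
    intro θ
    refine Finset.sum_le_sum fun j _ => Finset.sum_le_sum fun k _ => ?_
    refine (abs_add_le _ _).trans (add_le_add ?_ ?_) <;> rw [abs_mul]
    · rw [abs_neg]
      exact mul_le_of_le_one_left (abs_nonneg _) (Real.abs_sin_le_one θ)
    · exact mul_le_of_le_one_left (abs_nonneg _) (Real.abs_cos_le_one θ)
  choose K hK0 hK using g₁
  have hint : ∀ {Ψ : (J → ℝ) → ℝ}, ExpGrowth Ψ → Continuous Ψ → ∀ θ,
      Integrable (fun x => Ψ (linForms (c θ) x)) (gaussianPi κ) := fun hg hΨ θ =>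
    (hg.comp_linForms (c θ)).integrable (hΨ.comp (continuous_linForms _))
  have hcont' : ∀ θ, Continuous fun x => ∑ j, Φ₁ j (linForms (c θ) x) * linForms (c' θ) x j :=
    fun θ => continuous_finsetSum _ fun j _ => ((c₁ j).comp (continuous_linForms _)).mul
      ((continuous_apply j).comp (continuous_linForms _))
  -- Differentiation under the integral. Since `|cos|, |sin| ≤ 1`, the constant `M` bounds the
  -- coefficients for all `θ` at once; the extra `+ 1` in the exponent of the dominating function
  -- absorbs the linear factor coming from `c'`.
  have key := (hasDerivAt_integral_of_dominated_loc_of_deriv_le (μ := gaussianPi κ)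
    (F := fun θ x => Φ (linForms (c θ) x))
    (F' := fun θ x => ∑ j, Φ₁ j (linForms (c θ) x) * linForms (c' θ) x j)
    (bound := fun x => ∑ j, (K j * M) * Real.exp ((K j * M + 1) * ∑ k, |x k|))
    (s := Set.univ) (x₀ := θ) Filter.univ_mem
    (Filter.Eventually.of_forall fun θ =>
      (c₀.comp (continuous_linForms (c θ))).aestronglyMeasurable)
    (hint g₀ c₀ θ) (hcont' θ).aestronglyMeasurable
    (ae_of_all _ fun x t _ => ?_) (integrable_finsetSum _ fun j _ =>
      (integrable_exp_sum_abs _).const_mul _) (ae_of_all _ fun x t _ => ?_)).2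
  · refine key.congr_deriv ?_
    have i1 : ∀ j k, Integrable (fun x => x k * Φ₁ j (linForms (c θ) x)) (gaussianPi κ) :=
      fun j k => ((expGrowth_coord k).mul (ExpGrowth.comp_linForms ⟨K j, hK0 j, hK j⟩ (c θ))).integrable
        ((continuous_apply k).mul ((c₁ j).comp (continuous_linForms _)))
    have i2 : ∀ i j, Integrable (fun x => Φ₂ i j (linForms (c θ) x)) (gaussianPi κ) :=
      fun i j => hint (g₂ i j) (c₂ i j) θ
    -- Integration by parts trades each factor `x k` for second derivatives, so only the products
    -- `⟨c' i, c j⟩` of coefficient vectors remain.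
    have ibp : ∀ i k, ∫ x, x k * Φ₁ i (linForms (c θ) x) ∂(gaussianPi κ) =
        ∑ j, c θ j k * ∫ x, Φ₂ i j (linForms (c θ) x) ∂(gaussianPi κ) := by
      intro i k
      rw [integral_coord_mul_gaussianPi k (f := fun x => Φ₁ i (linForms (c θ) x))
        (f' := fun x => ∑ j, Φ₂ i j (linForms (c θ) x) * c θ j k)
        (fun x t => (h₂ i).hasDerivAt_update (c θ) k x t) (hint ⟨K i, hK0 i, hK i⟩ (c₁ i) θ)
        (integrable_finsetSum _ fun j _ => (i2 i j).mul_const _) (i1 i k),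
        integral_finsetSum _ fun j _ => (i2 i j).mul_const _]
      refine Finset.sum_congr rfl fun j _ => ?_
      rw [integral_mul_const, mul_comm]
    have e1 : ∀ x, ∑ j, Φ₁ j (linForms (c θ) x) * linForms (c' θ) x j =
        ∑ j, ∑ k, c' θ j k * (x k * Φ₁ j (linForms (c θ) x)) := by
      intro x
      refine Finset.sum_congr rfl fun j _ => ?_
      rw [linForms, Finset.mul_sum]
      exact Finset.sum_congr rfl fun k _ => by ring
    simp only [e1]
    rw [integral_finsetSum _ fun j _ => integrable_finsetSum _ fun k _ => (i1 j k).const_mul _,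
      integral_finsetSum _ fun i _ => integrable_finsetSum _ fun j _ => (i2 i j).const_mul _]
    refine Finset.sum_congr rfl fun i _ => ?_
    rw [integral_finsetSum _ fun k _ => (i1 i k).const_mul _,
      integral_finsetSum _ fun j _ => (i2 i j).const_mul _]
    simp only [integral_const_mul, ibp, Finset.mul_sum]
    rw [Finset.sum_comm]
    refine Finset.sum_congr rfl fun j _ => ?_
    rw [Finset.sum_mul]
    exact Finset.sum_congr rfl fun k _ => by ring
  · have hS : 0 ≤ ∑ k, |x k| := Finset.sum_nonneg fun k _ => abs_nonneg _
    rw [Real.norm_eq_abs]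
    refine (Finset.abs_sum_le_sum_abs _ _).trans (Finset.sum_le_sum fun j _ => ?_)
    rw [abs_mul]
    have b1 : |Φ₁ j (linForms (c t) x)| ≤ K j * Real.exp (K j * M * ∑ k, |x k|) := by
      refine (hK j _).trans ?_
      have := (sum_abs_linForms_le (c t) x).trans (mul_le_mul_of_nonneg_right (hcM t) hS)
      have hKj := hK0 j
      rw [mul_assoc]
      gcongr
    have b2 : |linForms (c' t) x j| ≤ M * Real.exp (∑ k, |x k|) := by
      refine (abs_linForms_le (c' t) x j).trans
        ((mul_le_mul_of_nonneg_right (hcM' t) hS).trans (mul_le_mul_of_nonneg_left ?_ hM0))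
      linarith [Real.add_one_le_exp (∑ k, |x k|)]
    calc _ ≤ (K j * Real.exp (K j * M * ∑ k, |x k|)) * (M * Real.exp (∑ k, |x k|)) :=
          mul_le_mul b1 b2 (abs_nonneg _) (mul_nonneg (hK0 j) (Real.exp_pos _).le)
      _ = _ := by rw [add_mul, Real.exp_add, one_mul]; ring
  · refine h₁ (fun s => linForms (c s) x) (fun j => linForms (c' t) x j) t fun j => ?_
    unfold linForms
    refine HasDerivAt.fun_sum fun k _ => ?_
    exact (((Real.hasDerivAt_cos t).mul_const _).add ((Real.hasDerivAt_sin t).mul_const _)).mul_const _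

end

/-! ### The smooth maximum and its replicated exponential. -/

section
variable {ι R : Type*} [Fintype ι] [Fintype R]

/-- The smooth maximum `β⁻¹ log ∑ exp (β z_i)`. -/
noncomputable def softMax (β : ℝ) (z : ι → ℝ) : ℝ := β⁻¹ * Real.log (∑ i, Real.exp (β * z i))

/-- The Gibbs weights, which are the partial derivatives of `softMax`. -/
noncomputable def gibbs (β : ℝ) (i : ι) (z : ι → ℝ) : ℝ :=
  Real.exp (β * z i) / ∑ j, Real.exp (β * z j)

theorem sum_exp_pos [Nonempty ι] (β : ℝ) (z : ι → ℝ) : 0 < ∑ i, Real.exp (β * z i) :=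
  Finset.sum_pos (fun _ _ => Real.exp_pos _) Finset.univ_nonempty

theorem gibbs_nonneg (β : ℝ) (i : ι) (z : ι → ℝ) : 0 ≤ gibbs β i z :=
  div_nonneg (Real.exp_pos _).le (Finset.sum_nonneg fun _ _ => (Real.exp_pos _).le)

theorem sum_gibbs [Nonempty ι] (β : ℝ) (z : ι → ℝ) : ∑ i, gibbs β i z = 1 := by
  simp only [gibbs, ← Finset.sum_div]
  exact div_self (sum_exp_pos β z).ne'

theorem gibbs_le_one [Nonempty ι] (β : ℝ) (i : ι) (z : ι → ℝ) : gibbs β i z ≤ 1 := by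
  rw [← sum_gibbs β z]
  exact Finset.single_le_sum (f := fun i => gibbs β i z) (fun _ _ => gibbs_nonneg _ _ _)
    (Finset.mem_univ i)

theorem continuous_softMax [Nonempty ι] (β : ℝ) : Continuous (softMax β : (ι → ℝ) → ℝ) := by
  unfold softMax
  exact continuous_const.mul (Continuous.log (by fun_prop) fun z => (sum_exp_pos β z).ne')

theorem continuous_gibbs [Nonempty ι] (β : ℝ) (i : ι) : Continuous (gibbs β i) := by
  unfold gibbs
  exact Continuous.div (by fun_prop) (by fun_prop) fun z => (sum_exp_pos β z).ne'

theorem le_softMax {β : ℝ} (hβ : 0 < β) (z : ι → ℝ) (i : ι) : z i ≤ softMax β z := by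
  have : Real.exp (β * z i) ≤ ∑ i, Real.exp (β * z i) :=
    Finset.single_le_sum (f := fun i => Real.exp (β * z i)) (fun _ _ => (Real.exp_pos _).le)
      (Finset.mem_univ i)
  have h := Real.log_le_log (Real.exp_pos _) this
  rw [Real.log_exp] at h
  rw [softMax, inv_mul_eq_div, le_div_iff₀ hβ]
  linarith

/-- With `le_softMax` this bounds the cost of smoothing the maximum by `β⁻¹ log |ι|`, which
disappears as `β → ∞`. -/
theorem softMax_le [Nonempty ι] {β : ℝ} (hβ : 0 < β) {z : ι → ℝ} {M : ℝ} (h : ∀ i, z i ≤ M) :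
    softMax β z ≤ M + β⁻¹ * Real.log (Fintype.card ι) := by
  have hc : (0 : ℝ) < Fintype.card ι := by exact_mod_cast Fintype.card_pos
  have : ∑ i, Real.exp (β * z i) ≤ Fintype.card ι * Real.exp (β * M) := by
    refine (Finset.sum_le_sum fun i _ => Real.exp_le_exp.2
      (mul_le_mul_of_nonneg_left (h i) hβ.le)).trans ?_
    simp
  have h := Real.log_le_log (sum_exp_pos β z) this
  rw [Real.log_mul hc.ne' (Real.exp_pos _).ne', Real.log_exp] at h
  have := mul_le_mul_of_nonneg_left h (inv_pos.2 hβ).le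
  rw [mul_add, inv_mul_cancel_left₀ hβ.ne'] at this
  rw [softMax]
  linarith

theorem abs_softMax_le [Nonempty ι] {β : ℝ} (hβ : 0 < β) (z : ι → ℝ) :
    |softMax β z| ≤ ∑ i, |z i| + β⁻¹ * Real.log (Fintype.card ι) := by
  have hs : ∀ i, |z i| ≤ ∑ i, |z i| := fun i =>
    Finset.single_le_sum (f := fun i => |z i|) (fun _ _ => abs_nonneg _) (Finset.mem_univ i)
  have hl : 0 ≤ β⁻¹ * Real.log (Fintype.card ι) :=
    mul_nonneg (inv_pos.2 hβ).le (Real.log_natCast_nonneg _)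
  rw [abs_le]
  constructor
  · obtain ⟨i⟩ := ‹Nonempty ι›
    linarith [le_softMax hβ z i, neg_abs_le (z i), hs i]
  · exact softMax_le hβ fun i => (le_abs_self _).trans (hs i)

theorem hasPartials_softMax [Nonempty ι] {β : ℝ} (hβ : β ≠ 0) :
    HasPartials (softMax β : (ι → ℝ) → ℝ) (gibbs β) := by
  intro z z' t h
  have h1 : HasDerivAt (fun s => ∑ i, Real.exp (β * z s i))
      (∑ i, Real.exp (β * z t i) * (β * z' i)) t :=
    HasDerivAt.fun_sum fun i _ => ((h i).const_mul β).exp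
  refine ((h1.log (sum_exp_pos β (z t)).ne').const_mul β⁻¹).congr_deriv ?_
  rw [Finset.sum_div, Finset.mul_sum]
  refine Finset.sum_congr rfl fun i _ => ?_
  rw [gibbs]
  field_simp

theorem hasPartials_gibbs [Nonempty ι] [DecidableEq ι] (β : ℝ) (i : ι) :
    HasPartials (gibbs β i) fun j z => β * (gibbs β i z * ((if i = j then 1 else 0) - gibbs β j z)) := by
  intro z z' t h
  have h1 : HasDerivAt (fun s => ∑ i, Real.exp (β * z s i))
      (∑ i, Real.exp (β * z t i) * (β * z' i)) t :=
    HasDerivAt.fun_sum fun i _ => ((h i).const_mul β).exp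
  have hS := (sum_exp_pos β (z t)).ne'
  refine (((h i).const_mul β).exp.div h1 hS).congr_deriv ?_
  have e : ∑ j, β * (gibbs β i (z t) * ((if i = j then 1 else 0) - gibbs β j (z t))) * z' j =
      β * gibbs β i (z t) * z' i - β * gibbs β i (z t) * ∑ j, gibbs β j (z t) * z' j := by
    rw [Finset.mul_sum]
    have : β * gibbs β i (z t) * z' i =
        ∑ j, β * gibbs β i (z t) * ((if i = j then 1 else 0) * z' j) := by
      simp
    rw [this, ← Finset.sum_sub_distrib]
    exact Finset.sum_congr rfl fun j _ => by ring
  have e2 : ∑ j, gibbs β j (z t) * z' j =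
      (∑ j, Real.exp (β * z t j) * z' j) / ∑ j, Real.exp (β * z t j) := by
    rw [Finset.sum_div]
    exact Finset.sum_congr rfl fun j _ => by rw [gibbs]; ring
  have e3 : ∑ i, Real.exp (β * z t i) * (β * z' i) = β * ∑ j, Real.exp (β * z t j) * z' j := by
    rw [Finset.mul_sum]
    exact Finset.sum_congr rfl fun j _ => by ring
  rw [e, e2, e3, gibbs]
  field_simp

/-- The exponential of a sum of smooth maxima over replicas. -/
noncomputable def replicaExp (s β : ℝ) (z : R × ι → ℝ) : ℝ :=
  Real.exp (s * ∑ k, softMax β fun i => z (k, i))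

/-- The first partial derivatives of `replicaExp`. -/
noncomputable def replicaExp₁ (s β : ℝ) (p : R × ι) (z : R × ι → ℝ) : ℝ :=
  s * gibbs β p.2 (fun i => z (p.1, i)) * replicaExp s β z

open Classical in
/-- The second partial derivatives of `replicaExp`. -/
noncomputable def replicaExp₂ (s β : ℝ) (p q : R × ι) (z : R × ι → ℝ) : ℝ :=
  ((if p.1 = q.1 then s * (β * (gibbs β p.2 (fun i => z (p.1, i)) *
      ((if p.2 = q.2 then 1 else 0) - gibbs β q.2 (fun i => z (p.1, i))))) else 0) +
    s * gibbs β p.2 (fun i => z (p.1, i)) * (s * gibbs β q.2 (fun i => z (q.1, i)))) *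
    replicaExp s β z

theorem hasPartials_replicaExp [Nonempty ι] (s : ℝ) {β : ℝ} (hβ : β ≠ 0) :
    HasPartials (replicaExp s β : (R × ι → ℝ) → ℝ) (replicaExp₁ s β) := by
  intro z z' t h
  have h1 : HasDerivAt (fun r => s * ∑ k, softMax β fun i => z r (k, i))
      (s * ∑ k, ∑ i, gibbs β i (fun i => z t (k, i)) * z' (k, i)) t :=
    (HasDerivAt.fun_sum fun k _ => hasPartials_softMax hβ (fun r i => z r (k, i))
      (fun i => z' (k, i)) t fun i => h (k, i)).const_mul s
  refine h1.exp.congr_deriv ?_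
  simp only [replicaExp₁, Fintype.sum_prod_type, Finset.mul_sum, replicaExp]
  exact Finset.sum_congr rfl fun k _ => Finset.sum_congr rfl fun i _ => by ring

theorem hasPartials_replicaExp₁ [Nonempty ι] (s : ℝ) {β : ℝ} (hβ : β ≠ 0) (p : R × ι) :
    HasPartials (replicaExp₁ s β p) (replicaExp₂ s β p) := by
  classical
  intro z z' t h
  obtain ⟨k, i⟩ := p
  have h1 := hasPartials_gibbs β i (fun r i => z r (k, i)) (fun i => z' (k, i)) t fun i => h (k, i)
  refine ((h1.const_mul s).mul (hasPartials_replicaExp s hβ z z' t h)).congr_deriv ?_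
  have e : ∀ q : R × ι, replicaExp₂ s β (k, i) q (z t) * z' q =
      (if k = q.1 then s * (β * (gibbs β i (fun i => z t (k, i)) *
      ((if i = q.2 then 1 else 0) - gibbs β q.2 (fun i => z t (k, i))))) * z' q *
        replicaExp s β (z t) else 0) +
      s * gibbs β i (fun i => z t (k, i)) * (replicaExp₁ s β q (z t) * z' q) := by
    intro q
    simp only [replicaExp₂, replicaExp₁]
    split_ifs <;> ring
  simp only [e, Finset.sum_add_distrib, ← Finset.mul_sum]
  congr 1
  simp only [Fintype.sum_prod_type]
  rw [Finset.sum_comm]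
  simp only [Finset.sum_ite_eq, Finset.mem_univ, if_true]
  rw [Finset.mul_sum, Finset.sum_mul]
  exact Finset.sum_congr rfl fun j _ => by ring

theorem continuous_replicaExp [Nonempty ι] (s β : ℝ) :
    Continuous (replicaExp s β : (R × ι → ℝ) → ℝ) := by
  unfold replicaExp
  refine Real.continuous_exp.comp (continuous_const.mul (continuous_finsetSum _ fun k _ => ?_))
  exact (continuous_softMax β).comp (by fun_prop)

theorem continuous_gibbs_slice {ι R : Type*} [Fintype ι] [Nonempty ι] (β : ℝ) (k : R) (i : ι) :
    Continuous fun z : R × ι → ℝ => gibbs β i fun i => z (k, i) :=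
  (continuous_gibbs β i).comp (by fun_prop)

theorem continuous_replicaExp₁ [Nonempty ι] (s β : ℝ) (p : R × ι) :
    Continuous (replicaExp₁ s β p) :=
  (continuous_const.mul (continuous_gibbs_slice β _ _)).mul (continuous_replicaExp s β)

theorem continuous_replicaExp₂ [Nonempty ι] (s β : ℝ) (p q : R × ι) :
    Continuous (replicaExp₂ s β p q) := by
  unfold replicaExp₂
  refine Continuous.mul (Continuous.add ?_ ?_) (continuous_replicaExp s β)
  · by_cases h : p.1 = q.1
    · simp only [h, if_true]
      exact continuous_const.mul (continuous_const.mul ((continuous_gibbs_slice β _ _).mul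
        (continuous_const.sub (continuous_gibbs_slice β _ _))))
    · simp only [h, if_false]
      exact continuous_const
  · exact (continuous_const.mul (continuous_gibbs_slice β _ _)).mul
      (continuous_const.mul (continuous_gibbs_slice β _ _))

theorem expGrowth_replicaExp [Nonempty ι] {s β : ℝ} (hs : 0 ≤ s) (hβ : 0 < β) :
    ExpGrowth (replicaExp s β : (R × ι → ℝ) → ℝ) := by
  set C := β⁻¹ * Real.log (Fintype.card ι)
  have hb : ∀ z : R × ι → ℝ, |replicaExp s β z| ≤
      Real.exp (s * (Fintype.card R * C)) * Real.exp (s * ∑ p, |z p|) := by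
    intro z
    rw [← Real.exp_add, ← mul_add, replicaExp, Real.abs_exp, Real.exp_le_exp]
    refine mul_le_mul_of_nonneg_left ?_ hs
    refine (Finset.sum_le_sum fun k _ => (le_abs_self _).trans (abs_softMax_le hβ _)).trans ?_
    rw [Finset.sum_add_distrib, Fintype.sum_prod_type]
    simp [C, add_comm]
  refine ⟨Real.exp (s * (Fintype.card R * C)) + s, by positivity, fun z => (hb z).trans ?_⟩
  have hS : 0 ≤ ∑ p, |z p| := Finset.sum_nonneg fun _ _ => abs_nonneg _
  refine mul_le_mul (by linarith) (Real.exp_le_exp.2 (mul_le_mul_of_nonneg_right ?_ hS))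
    (Real.exp_pos _).le (by positivity)
  linarith [Real.exp_pos (s * (Fintype.card R * C))]

theorem expGrowth_replicaExp₁ [Nonempty ι] {s β : ℝ} (hs : 0 ≤ s) (hβ : 0 < β) (p : R × ι) :
    ExpGrowth (replicaExp₁ s β p) := by
  refine ((expGrowth_const s).mul (expGrowth_replicaExp hs hβ)).of_abs_le fun z => ?_
  rw [replicaExp₁, abs_mul, abs_mul, abs_mul, abs_of_nonneg (gibbs_nonneg _ _ _)]
  refine mul_le_mul_of_nonneg_right ?_ (abs_nonneg _)
  exact mul_le_of_le_one_right (abs_nonneg _) (gibbs_le_one _ _ _)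

theorem expGrowth_replicaExp₂ [Nonempty ι] {s β : ℝ} (hs : 0 ≤ s) (hβ : 0 < β) (p q : R × ι) :
    ExpGrowth (replicaExp₂ s β p q) := by
  refine ((expGrowth_const (s * β + s * s)).mul (expGrowth_replicaExp hs hβ)).of_abs_le fun z => ?_
  rw [replicaExp₂, abs_mul, abs_mul]
  refine mul_le_mul_of_nonneg_right ?_ (abs_nonneg _)
  rw [abs_of_nonneg (a := s * β + s * s) (by positivity)]
  have g0 := gibbs_nonneg β p.2 (fun i => z (p.1, i))
  have g1 := gibbs_le_one β p.2 (fun i => z (p.1, i))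
  refine (abs_add_le _ _).trans (add_le_add ?_ ?_)
  · split_ifs with h h'
    · have h0 := gibbs_nonneg β q.2 (fun i => z (p.1, i))
      have h1 := gibbs_le_one β q.2 (fun i => z (p.1, i))
      rw [abs_mul, abs_mul, abs_mul, abs_of_nonneg hs, abs_of_nonneg hβ.le, abs_of_nonneg g0,
        abs_of_nonneg (sub_nonneg.2 h1), ← mul_assoc]
      exact mul_le_of_le_one_right (by positivity)
        (mul_le_one₀ g1 (sub_nonneg.2 h1) (by linarith))
    · have h0 := gibbs_nonneg β q.2 (fun i => z (p.1, i))
      have h1 := gibbs_le_one β q.2 (fun i => z (p.1, i))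
      rw [abs_mul, abs_mul, abs_mul, abs_of_nonneg hs, abs_of_nonneg hβ.le, abs_of_nonneg g0,
        zero_sub, abs_neg, abs_of_nonneg h0, ← mul_assoc]
      exact mul_le_of_le_one_right (by positivity) (mul_le_one₀ g1 h0 h1)
    · simpa using by positivity
  · have h0 := gibbs_nonneg β q.2 (fun i => z (q.1, i))
    have h1 := gibbs_le_one β q.2 (fun i => z (q.1, i))
    rw [abs_of_nonneg (by positivity)]
    exact mul_le_mul (mul_le_of_le_one_right hs g1) (mul_le_of_le_one_right hs h1)
      (by positivity) hs

end

/-! ### Comparison of exponential moments. -/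

section
variable {ι R κ κ' : Type*} [Fintype ι] [Fintype R] [Fintype κ] [Fintype κ']

/-- Because the weights sum to one, the contraction equals `½ ∑ p i p j (D i i + D j j - 2 D i j)`:
only increments of `D` matter, as in the Sudakov–Fernique comparison. -/
theorem sum_mul_gibbs_hessian_nonneg [DecidableEq ι] {D : ι → ι → ℝ}
    (hD : ∀ i j, 0 ≤ D i i + D j j - 2 * D i j) {p : ι → ℝ} (hp : ∀ i, 0 ≤ p i)
    (hp1 : ∑ i, p i = 1) :
    0 ≤ ∑ i, ∑ j, D i j * (p i * ((if i = j then 1 else 0) - p j)) := by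
  have e : ∑ i, ∑ j, D i j * (p i * ((if i = j then 1 else 0) - p j)) =
      ∑ i, ∑ j, 2⁻¹ * (p i * p j * (D i i + D j j - 2 * D i j)) := by
    have e1 : ∑ i, ∑ j, D i j * (p i * ((if i = j then 1 else 0) - p j)) =
        ∑ i, p i * D i i - ∑ i, ∑ j, p i * p j * D i j := by
      rw [← Finset.sum_sub_distrib]
      refine Finset.sum_congr rfl fun i _ => ?_
      have : p i * D i i = ∑ j, (if i = j then p i * D i j else 0) := by simp
      rw [this, ← Finset.sum_sub_distrib]
      refine Finset.sum_congr rfl fun j _ => ?_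
      split_ifs <;> ring
    have e2 : ∑ i, ∑ j, p i * p j * D i i = ∑ i, p i * D i i := by
      refine Finset.sum_congr rfl fun i _ => ?_
      rw [← Finset.sum_mul, ← Finset.mul_sum, hp1, mul_one]
    have e3 : ∑ i, ∑ j, p i * p j * D j j = ∑ i, p i * D i i := by
      rw [Finset.sum_comm, ← e2]
      exact Finset.sum_congr rfl fun i _ => Finset.sum_congr rfl fun j _ => by ring
    have e4 : ∑ i, ∑ j, 2⁻¹ * (p i * p j * (D i i + D j j - 2 * D i j)) =
        2⁻¹ * (∑ i, ∑ j, p i * p j * D i i + ∑ i, ∑ j, p i * p j * D j j -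
          2 * ∑ i, ∑ j, p i * p j * D i j) := by
      simp only [mul_sub, mul_add, Finset.sum_sub_distrib, Finset.sum_add_distrib, Finset.mul_sum]
      congr 1
      exact Finset.sum_congr rfl fun i _ => Finset.sum_congr rfl fun j _ => by ring
    rw [e1, e4, e2, e3]; ring
  rw [e]
  exact Finset.sum_nonneg fun i _ => Finset.sum_nonneg fun j _ =>
    mul_nonneg (by norm_num) (mul_nonneg (mul_nonneg (hp i) (hp j)) (hD i j))

/-- The integrand of the interpolation derivative splits into three parts. The Hessian of the smooth
maximum inside a replica contributes a nonnegative term by the increment comparison. The `B` part of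
the gradient products is nonnegative because `B` is positive semidefinite, and is dropped. The `A`
part couples all pairs of replicas; as `A ≤ 1` and each replica has total Gibbs weight one, it costs
at most `(s |R|)²`. -/
theorem neg_le_sum_replicaExp₂ [Nonempty ι] [DecidableEq R] {s β : ℝ} (hs : 0 ≤ s) (hβ : 0 ≤ β)
    {A B : ι → ι → ℝ} (hA : ∀ i j, A i j ≤ 1)
    (hAB : ∀ i j, A i i + A j j - 2 * A i j ≤ B i i + B j j - 2 * B i j)
    (hB : ∀ p : ι → ℝ, 0 ≤ ∑ i, ∑ j, B i j * (p i * p j)) (z : R × ι → ℝ) :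
    -((s * Fintype.card R) ^ 2 * replicaExp s β z) ≤
      ∑ p : R × ι, ∑ q : R × ι, ((if p.1 = q.1 then B p.2 q.2 else 0) - A p.2 q.2) *
        replicaExp₂ s β p q z := by
  classical
  set P : R → ι → ℝ := fun k i => gibbs β i (fun i => z (k, i)) with hP
  have hP0 : ∀ k i, 0 ≤ P k i := fun k i => gibbs_nonneg _ _ _
  have hP1 : ∀ k, ∑ i, P k i = 1 := fun k => sum_gibbs β fun i => z (k, i)
  set E := replicaExp s β z with hE
  have hE0 : 0 ≤ E := (Real.exp_pos _).le
  have e1 : ∀ p q : R × ι, ((if p.1 = q.1 then B p.2 q.2 else 0) - A p.2 q.2) *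
        replicaExp₂ s β p q z =
      (if p.1 = q.1 then
        s * β * E * ((B p.2 q.2 - A p.2 q.2) *
          (P p.1 p.2 * ((if p.2 = q.2 then 1 else 0) - P p.1 q.2))) +
        s ^ 2 * E * (B p.2 q.2 * (P p.1 p.2 * P p.1 q.2)) else 0) -
      s ^ 2 * E * (A p.2 q.2 * (P p.1 p.2 * P q.1 q.2)) := by
    rintro ⟨k, i⟩ ⟨l, j⟩
    simp only [replicaExp₂, ← hE]
    by_cases h : k = l
    · subst h; simp only [if_true, hP]; ring
    · simp only [h, if_false, hP]; ring
  have e2 : ∑ p : R × ι, ∑ q : R × ι, ((if p.1 = q.1 then B p.2 q.2 else 0) - A p.2 q.2) *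
        replicaExp₂ s β p q z =
      ∑ k, (s * β * E * (∑ i, ∑ j, (B i j - A i j) *
          (P k i * ((if i = j then 1 else 0) - P k j))) +
        s ^ 2 * E * ∑ i, ∑ j, B i j * (P k i * P k j)) -
      s ^ 2 * E * ∑ p : R × ι, ∑ q : R × ι, A p.2 q.2 * (P p.1 p.2 * P q.1 q.2) := by
    simp only [e1, Finset.sum_sub_distrib, ← Finset.mul_sum]
    congr 1
    rw [Fintype.sum_prod_type]
    refine Finset.sum_congr rfl fun k _ => ?_
    simp only [Fintype.sum_prod_type]
    rw [Finset.mul_sum, Finset.mul_sum, ← Finset.sum_add_distrib]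
    refine Finset.sum_congr rfl fun i _ => ?_
    rw [Finset.sum_comm]
    simp only [Finset.sum_ite_eq, Finset.mem_univ, if_true]
    rw [Finset.mul_sum, Finset.mul_sum, ← Finset.sum_add_distrib]
  have h1 : 0 ≤ ∑ k, (s * β * E * (∑ i, ∑ j, (B i j - A i j) *
          (P k i * ((if i = j then 1 else 0) - P k j))) +
        s ^ 2 * E * ∑ i, ∑ j, B i j * (P k i * P k j)) := by
    refine Finset.sum_nonneg fun k _ => add_nonneg (mul_nonneg (by positivity) ?_)
      (mul_nonneg (by positivity) (hB (P k)))
    exact sum_mul_gibbs_hessian_nonneg (D := fun i j => B i j - A i j)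
      (fun i j => by linarith [hAB i j]) (hP0 k) (hP1 k)
  have h2 : ∑ p : R × ι, ∑ q : R × ι, A p.2 q.2 * (P p.1 p.2 * P q.1 q.2) ≤
      (Fintype.card R : ℝ) ^ 2 := by
    have hs1 : ∑ p : R × ι, P p.1 p.2 = Fintype.card R := by
      simp [Fintype.sum_prod_type, hP1]
    calc _ ≤ ∑ p : R × ι, ∑ q : R × ι, P p.1 p.2 * P q.1 q.2 :=
          Finset.sum_le_sum fun p _ => Finset.sum_le_sum fun q _ =>
            mul_le_of_le_one_left (mul_nonneg (hP0 _ _) (hP0 _ _)) (hA _ _)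
      _ = _ := by rw [← Finset.sum_mul_sum, hs1, sq]
  rw [e2]
  have := mul_le_mul_of_nonneg_left h2 (mul_nonneg (sq_nonneg s) hE0)
  nlinarith

/-- Splitting a standard Gaussian vector into one block and a family of independent copies of
another block. -/
theorem measurePreserving_sumElim_uncurry :
    MeasurePreserving (fun p : (κ → ℝ) × (R → κ' → ℝ) =>
        (Sum.elim p.1 (fun q : R × κ' => p.2 q.1 q.2) : κ ⊕ R × κ' → ℝ))
      ((gaussianPi κ).prod (Measure.pi fun _ : R => gaussianPi κ'))
      (gaussianPi (κ ⊕ R × κ')) := by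
  have hm : Measurable (fun p : (κ → ℝ) × (R → κ' → ℝ) =>
        (Sum.elim p.1 (fun q : R × κ' => p.2 q.1 q.2) : κ ⊕ R × κ' → ℝ)) := by
    refine measurable_pi_lambda _ fun i => ?_
    rcases i with i | i <;> simp only [Sum.elim_inl, Sum.elim_inr] <;> fun_prop
  refine ⟨hm, ?_⟩
  symm
  refine Measure.pi_eq fun s hs => ?_
  rw [Measure.map_apply hm (MeasurableSet.univ_pi hs)]
  have e : (fun p : (κ → ℝ) × (R → κ' → ℝ) =>
        (Sum.elim p.1 (fun q : R × κ' => p.2 q.1 q.2) : κ ⊕ R × κ' → ℝ)) ⁻¹' Set.pi Set.univ s =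
      (Set.pi Set.univ fun k => s (Sum.inl k)) ×ˢ
        (Set.pi Set.univ fun r => Set.pi Set.univ fun k => s (Sum.inr (r, k))) := by
    ext p
    simp [Set.mem_pi]
  rw [e, Measure.prod_prod, Measure.pi_pi, Measure.pi_pi, Fintype.prod_sum_type,
    Fintype.prod_prod_type]
  simp only [Measure.pi_pi]

/-- Comparison of the exponential moment of a smooth maximum of a Gaussian process `⟨a_i, g⟩`
with `N` independent copies of a Gaussian process `⟨b_i, g⟩` having larger increments. -/
theorem integral_exp_softMax_le_pow [Nonempty ι] {a : ι → κ → ℝ} {b : ι → κ' → ℝ}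
    (ha : ∀ i j, ∑ k, a i k * a j k ≤ 1)
    (hab : ∀ i j, ∑ k, a i k * a i k + ∑ k, a j k * a j k - 2 * ∑ k, a i k * a j k ≤
      ∑ k, b i k * b i k + ∑ k, b j k * b j k - 2 * ∑ k, b i k * b j k)
    {β : ℝ} (hβ : 0 < β) {l : ℝ} (hl : 0 ≤ l) {N : ℕ} (hN : N ≠ 0) :
    ∫ x, Real.exp (l * softMax β (linForms a x)) ∂(gaussianPi κ) ≤
      Real.exp (l ^ 2 / 2) *
        (∫ y, Real.exp (l / N * softMax β (linForms b y)) ∂(gaussianPi κ')) ^ N := by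
  classical
  have hN' : (N : ℝ) ≠ 0 := by exact_mod_cast hN
  set s : ℝ := l / N with hs
  have hs0 : 0 ≤ s := by positivity
  -- All replicas of `a` read the same Gaussian block, while replica `k` of `b` reads its own block.
  -- With `s = l / N` the endpoint `θ = 0` gives the moment at `l`, and `θ = π / 2` gives the `N`-th
  -- power of the moment at `l / N`.
  set a' : Fin N × ι → (κ ⊕ Fin N × κ') → ℝ := fun p => Sum.elim (a p.2) 0 with ha'
  set b' : Fin N × ι → (κ ⊕ Fin N × κ') → ℝ :=
    fun p => Sum.elim 0 (fun q => if p.1 = q.1 then b p.2 q.2 else 0) with hb'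
  set c : ℝ → Fin N × ι → (κ ⊕ Fin N × κ') → ℝ :=
    fun θ j k => Real.cos θ * a' j k + Real.sin θ * b' j k with hc
  set H : ℝ → ℝ := fun θ => ∫ x, replicaExp s β (linForms (c θ) x)
    ∂(gaussianPi (κ ⊕ Fin N × κ')) with hH
  have hderiv := hasDerivAt_integral_interpolation (κ := κ ⊕ Fin N × κ')
    (hasPartials_replicaExp (R := Fin N) (ι := ι) s hβ.ne')
    (hasPartials_replicaExp₁ s hβ.ne') (continuous_replicaExp s β) (continuous_replicaExp₁ s β)
    (continuous_replicaExp₂ s β) (expGrowth_replicaExp hs0 hβ) (expGrowth_replicaExp₁ hs0 hβ)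
    (expGrowth_replicaExp₂ hs0 hβ) a' b'
  have hcoef : ∀ θ (p q : Fin N × ι), ∑ k, (-Real.sin θ * a' p k + Real.cos θ * b' p k) *
      (Real.cos θ * a' q k + Real.sin θ * b' q k) = (Real.sin θ * Real.cos θ) *
        ((if p.1 = q.1 then ∑ k, b p.2 k * b q.2 k else 0) - ∑ k, a p.2 k * a q.2 k) := by
    rintro θ ⟨k, i⟩ ⟨r, j⟩
    simp only [ha', hb', Fintype.sum_sum_type, Sum.elim_inl, Sum.elim_inr, Pi.zero_apply, mul_zero,
      add_zero, zero_add, Fintype.sum_prod_type]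
    have : ∀ t : Fin N, ∑ q, Real.cos θ * (if k = t then b i q else 0) *
        (Real.sin θ * (if r = t then b j q else 0)) =
        if k = t then (if k = r then Real.sin θ * Real.cos θ * ∑ q, b i q * b j q else 0) else 0 := by
      intro t
      by_cases h : k = t
      · subst h
        by_cases h' : k = r
        · subst h'
          simp only [if_true, Finset.mul_sum]
          exact Finset.sum_congr rfl fun q _ => by ring
        · simp [h', Ne.symm h']
      · simp [h]
    simp only [this, Finset.sum_ite_eq, Finset.mem_univ, if_true]
    have e : ∑ q, -Real.sin θ * a i q * (Real.cos θ * a j q) =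
        -(Real.sin θ * Real.cos θ * ∑ q, a i q * a j q) := by
      rw [Finset.mul_sum, ← Finset.sum_neg_distrib]
      exact Finset.sum_congr rfl fun q _ => by ring
    rw [e]
    split_ifs <;> ring
  have hint : ∀ θ, Integrable (fun x => replicaExp s β (linForms (c θ) x))
      (gaussianPi (κ ⊕ Fin N × κ')) := fun θ =>
    ((expGrowth_replicaExp hs0 hβ).comp_linForms (c θ)).integrable
      ((continuous_replicaExp s β).comp (continuous_linForms _))
  have hsN : s * (Fintype.card (Fin N) : ℝ) = l := by
    rw [Fintype.card_fin, hs, div_mul_cancel₀ _ hN']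
  have hlow : ∀ θ ∈ Set.Icc 0 (Real.pi / 2), -(l ^ 2 * (Real.sin θ * Real.cos θ)) * H θ ≤
      ∫ x, ∑ i, ∑ j, (∑ k, (-Real.sin θ * a' i k + Real.cos θ * b' i k) *
          (Real.cos θ * a' j k + Real.sin θ * b' j k)) *
          replicaExp₂ s β i j (linForms (c θ) x) ∂(gaussianPi (κ ⊕ Fin N × κ')) := by
    intro θ hθ
    have hsc : 0 ≤ Real.sin θ * Real.cos θ :=
      mul_nonneg (Real.sin_nonneg_of_nonneg_of_le_pi hθ.1 (by linarith [hθ.2, Real.pi_pos]))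
        (Real.cos_nonneg_of_neg_pi_div_two_le_of_le (by linarith [hθ.1, Real.pi_pos]) hθ.2)
    rw [hH, ← integral_const_mul]
    refine integral_mono ((hint θ).const_mul _) (integrable_finsetSum _ fun i _ =>
      integrable_finsetSum _ fun j _ => Integrable.const_mul
        (((expGrowth_replicaExp₂ hs0 hβ i j).comp_linForms (c θ)).integrable
        ((continuous_replicaExp₂ s β i j).comp (continuous_linForms _))) _) fun x => ?_
    have := neg_le_sum_replicaExp₂ (R := Fin N) hs0 hβ.le (A := fun i j => ∑ k, a i k * a j k)
      (B := fun i j => ∑ k, b i k * b j k) ha hab (fun p => ?_) (linForms (c θ) x)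
    · rw [hsN] at this
      simp only [hcoef, mul_assoc, ← Finset.mul_sum]
      have := mul_le_mul_of_nonneg_left this hsc
      simp only [mul_assoc] at this
      refine le_trans (le_of_eq ?_) this
      ring
    -- A Gram matrix is positive semidefinite.
    · have e : ∑ i, ∑ j, (∑ k, b i k * b j k) * (p i * p j) = ∑ k, (∑ i, b i k * p i) ^ 2 := by
        have e₀ : ∀ k, (∑ i, b i k * p i) ^ 2 = ∑ i, ∑ j, b i k * p i * (b j k * p j) := fun k => by
          rw [sq, Finset.sum_mul_sum]
        simp only [e₀, Finset.sum_mul]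
        symm
        rw [Finset.sum_comm]
        refine Finset.sum_congr rfl fun i _ => ?_
        rw [Finset.sum_comm]
        exact Finset.sum_congr rfl fun j _ => Finset.sum_congr rfl fun k _ => by ring
      rw [e]
      exact Finset.sum_nonneg fun k _ => sq_nonneg _
  -- The lower bound `H' ≥ -l² sin θ cos θ H` has integrating factor `exp (l² sin² θ / 2)`; its
  -- value at `π / 2` is the factor `exp (l² / 2)` of the conclusion.
  have hmono : MonotoneOn (fun θ => H θ * Real.exp (l ^ 2 * Real.sin θ ^ 2 / 2))
      (Set.Icc 0 (Real.pi / 2)) := by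
    have hd : ∀ θ, HasDerivAt (fun θ => H θ * Real.exp (l ^ 2 * Real.sin θ ^ 2 / 2))
        ((∫ x, ∑ i, ∑ j, (∑ k, (-Real.sin θ * a' i k + Real.cos θ * b' i k) *
          (Real.cos θ * a' j k + Real.sin θ * b' j k)) *
          replicaExp₂ s β i j (linForms (c θ) x) ∂(gaussianPi (κ ⊕ Fin N × κ'))) *
          Real.exp (l ^ 2 * Real.sin θ ^ 2 / 2) +
          H θ * (Real.exp (l ^ 2 * Real.sin θ ^ 2 / 2) * (l ^ 2 * (Real.sin θ * Real.cos θ)))) θ := by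
      intro θ
      have h1 : HasDerivAt (fun θ => l ^ 2 * Real.sin θ ^ 2 / 2)
          (l ^ 2 * (Real.sin θ * Real.cos θ)) θ := by
        refine ((((Real.hasDerivAt_sin θ).pow 2).const_mul (l ^ 2)).div_const 2).congr_deriv ?_
        simp; ring
      exact (hderiv θ).mul h1.exp
    refine monotoneOn_of_deriv_nonneg (convex_Icc _ _)
      (fun θ _ => (hd θ).continuousAt.continuousWithinAt)
      (fun θ _ => (hd θ).differentiableAt.differentiableWithinAt) fun θ hθ => ?_
    rw [(hd θ).deriv]
    have h1 := hlow θ (interior_subset hθ)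
    have h2 := Real.exp_pos (l ^ 2 * Real.sin θ ^ 2 / 2)
    have h3 := mul_le_mul_of_nonneg_right h1 h2.le
    linarith
  have hfin := hmono (Set.left_mem_Icc.2 (by positivity)) (Set.right_mem_Icc.2 (by positivity))
    (by positivity : (0 : ℝ) ≤ Real.pi / 2)
  simp only [Real.sin_zero, Real.sin_pi_div_two] at hfin
  have mp := measurePreserving_sumElim_uncurry (κ := κ) (κ' := κ') (R := Fin N)
  have hsplit : ∀ θ, H θ = ∫ p : (κ → ℝ) × (Fin N → κ' → ℝ), replicaExp s β (linForms (c θ)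
      (Sum.elim p.1 (fun q : Fin N × κ' => p.2 q.1 q.2)))
      ∂((gaussianPi κ).prod (Measure.pi fun _ : Fin N => gaussianPi κ')) := by
    intro θ
    rw [hH]
    simp only
    rw [← mp.map_eq, integral_map mp.measurable.aemeasurable]
    rw [mp.map_eq]; exact (hint θ).aestronglyMeasurable
  have hH0 : H 0 = ∫ x, Real.exp (l * softMax β (linForms a x)) ∂(gaussianPi κ) := by
    rw [hsplit]
    have : ∀ p : (κ → ℝ) × (Fin N → κ' → ℝ), replicaExp s β (linForms (c 0)
      (Sum.elim p.1 (fun q : Fin N × κ' => p.2 q.1 q.2))) =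
        Real.exp (l * softMax β (linForms a p.1)) := by
      intro p
      have : ∀ k i, linForms (c 0) (Sum.elim p.1 (fun q : Fin N × κ' => p.2 q.1 q.2)) (k, i) =
          linForms a p.1 i := by
        intro k i
        simp [linForms, hc, ha']
      simp only [replicaExp, this, Finset.sum_const, Finset.card_univ, nsmul_eq_mul]
      rw [← mul_assoc, hsN]
    simp only [this]
    rw [integral_fun_fst (fun x => Real.exp (l * softMax β (linForms a x)))]
    simp
  have hH1 : H (Real.pi / 2) =
      (∫ y, Real.exp (l / N * softMax β (linForms b y)) ∂(gaussianPi κ')) ^ N := by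
    rw [hsplit]
    have : ∀ p : (κ → ℝ) × (Fin N → κ' → ℝ), replicaExp s β (linForms (c (Real.pi / 2))
      (Sum.elim p.1 (fun q : Fin N × κ' => p.2 q.1 q.2))) =
        ∏ k, Real.exp (l / N * softMax β (linForms b (p.2 k))) := by
      intro p
      have : ∀ k i, linForms (c (Real.pi / 2))
          (Sum.elim p.1 (fun q : Fin N × κ' => p.2 q.1 q.2)) (k, i) = linForms b (p.2 k) i := by
        intro k i
        simp [linForms, hc, hb', Fintype.sum_prod_type]
      simp only [replicaExp, this, ← Real.exp_sum, ← Finset.mul_sum, hs]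
    simp only [this]
    rw [integral_fun_snd (fun y : Fin N → κ' → ℝ =>
      ∏ k, Real.exp (l / N * softMax β (linForms b (y k)))),
      integral_fintype_prod_eq_pow (fun y => Real.exp (l / N * softMax β (linForms b y)))]
    simp
  rw [hH0, hH1] at hfin
  simpa [mul_comm] using hfin

end

/-! ### Tail bound for the maximum of a Gaussian process. -/

section
variable {ι κ κ' : Type*} [Fintype ι] [Fintype κ] [Fintype κ']

theorem expGrowth_exp_softMax [Nonempty ι] {β : ℝ} (hβ : 0 < β) (l : ℝ) :
    ExpGrowth (fun z : ι → ℝ => Real.exp (l * softMax β z)) := by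
  set C := β⁻¹ * Real.log (Fintype.card ι)
  refine ⟨Real.exp (|l| * C) + |l|, by positivity, fun z => ?_⟩
  have hS : 0 ≤ ∑ p, |z p| := Finset.sum_nonneg fun _ _ => abs_nonneg _
  have hb : |Real.exp (l * softMax β z)| ≤ Real.exp (|l| * C) * Real.exp (|l| * ∑ p, |z p|) := by
    rw [← Real.exp_add, ← mul_add, Real.abs_exp, Real.exp_le_exp, add_comm C]
    refine (le_abs_self _).trans ?_
    rw [abs_mul]
    exact mul_le_mul_of_nonneg_left (abs_softMax_le hβ z) (abs_nonneg l)
  refine hb.trans (mul_le_mul (by linarith [abs_nonneg l])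
    (Real.exp_le_exp.2 (mul_le_mul_of_nonneg_right ?_ hS)) (Real.exp_pos _).le (by positivity))
  linarith [Real.exp_pos (|l| * C)]

theorem integrable_exp_softMax_linForms [Nonempty ι] (c : ι → κ → ℝ) {β : ℝ} (hβ : 0 < β) (l : ℝ) :
    Integrable (fun x => Real.exp (l * softMax β (linForms c x))) (gaussianPi κ) :=
  ((expGrowth_exp_softMax hβ l).comp_linForms c).integrable
    ((Real.continuous_exp.comp (continuous_const.mul (continuous_softMax β))).comp
      (continuous_linForms c))

theorem interior_integrableExpSet_softMax_linForms [Nonempty ι] (c : ι → κ → ℝ) {β : ℝ}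
    (hβ : 0 < β) : interior (integrableExpSet (fun x => softMax β (linForms c x)) (gaussianPi κ)) =
      Set.univ := by
  have : integrableExpSet (fun x => softMax β (linForms c x)) (gaussianPi κ) = Set.univ :=
    Set.eq_univ_of_forall fun l => integrable_exp_softMax_linForms c hβ l
  rw [this, interior_univ]

/-- `(E exp (l X / N)) ^ N → exp (l E X)`. -/
theorem tendsto_mgf_div_pow {Ω : Type*} [MeasurableSpace Ω] {P : Measure Ω}
    [IsProbabilityMeasure P] {X : Ω → ℝ} (hX : interior (integrableExpSet X P) = Set.univ) (l : ℝ) :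
    Filter.Tendsto (fun N : ℕ => mgf X P (l / N) ^ N) Filter.atTop
      (nhds (Real.exp (l * ∫ ω, X ω ∂P))) := by
  have hmem : ∀ t, t ∈ interior (integrableExpSet X P) := fun t => hX ▸ Set.mem_univ t
  have hpos : ∀ t, 0 < mgf X P t := fun t => mgf_pos (integrable_of_mem_integrableExpSet (interior_subset (hmem t)))
  have hd : HasDerivAt (cgf X P) (∫ ω, X ω ∂P) (l * 0) := by
    have h := (analyticAt_cgf (hmem 0)).differentiableAt.hasDerivAt
    rw [deriv_cgf_zero (hmem 0)] at h
    simpa using h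
  have hd2 : HasDerivAt (fun t => cgf X P (l * t)) (l * ∫ ω, X ω ∂P) 0 := by
    refine (hd.comp (0 : ℝ) ((hasDerivAt_id (0 : ℝ)).const_mul l)).congr_deriv ?_
    simp [mul_comm]
  -- The logarithm of the `N`-th power is `N · cgf (l / N)`, a difference quotient at `0` with step
  -- `1 / N`; its limit is `l` times the derivative of the cumulant generating function at `0`,
  -- namely the mean.
  have hlim := (hasDerivAt_iff_tendsto_slope_zero.1 hd2).comp
    ((tendsto_inv_atTop_nhdsGT_zero.mono_right (nhdsWithin_mono _ fun x hx => ne_of_gt hx)).comp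
      tendsto_natCast_atTop_atTop)
  refine ((Real.continuous_exp.tendsto _).comp hlim).congr fun N => ?_
  simp only [Function.comp_apply, inv_inv, zero_add, mul_zero, cgf_zero, sub_zero, smul_eq_mul]
  rw [← div_eq_mul_inv, cgf, Real.exp_nat_mul, Real.exp_log (hpos _)]

/-- Exponential moments of a smooth maximum of a Gaussian process `⟨a_i, g⟩` are controlled by
the mean of the smooth maximum of a Gaussian process `⟨b_i, g⟩` with larger increments. -/
theorem integral_exp_softMax_le [Nonempty ι] {a : ι → κ → ℝ} {b : ι → κ' → ℝ}
    (ha : ∀ i j, ∑ k, a i k * a j k ≤ 1)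
    (hab : ∀ i j, ∑ k, a i k * a i k + ∑ k, a j k * a j k - 2 * ∑ k, a i k * a j k ≤
      ∑ k, b i k * b i k + ∑ k, b j k * b j k - 2 * ∑ k, b i k * b j k)
    {β : ℝ} (hβ : 0 < β) {l : ℝ} (hl : 0 ≤ l) :
    ∫ x, Real.exp (l * softMax β (linForms a x)) ∂(gaussianPi κ) ≤
      Real.exp (l ^ 2 / 2 + l * ∫ y, softMax β (linForms b y) ∂(gaussianPi κ')) := by
  rw [Real.exp_add]
  -- Averaging over infinitely many independent copies removes the fluctuations of the `b` process,
  -- so only the variance bound on `a` appears in the exponent.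
  refine ge_of_tendsto ((tendsto_mgf_div_pow
    (interior_integrableExpSet_softMax_linForms b hβ) l).const_mul (Real.exp (l ^ 2 / 2))) ?_
  filter_upwards [Filter.eventually_ne_atTop 0] with N hN
  exact integral_exp_softMax_le_pow ha hab hβ hl hN

/-- Tail bound for the maximum of a Gaussian process with unit variances, centred at the mean of
an upper bound for a Gaussian process with larger increments. -/
theorem measureReal_exists_le_linForms [Nonempty ι] {a : ι → κ → ℝ} {b : ι → κ' → ℝ}
    (ha : ∀ i j, ∑ k, a i k * a j k ≤ 1)
    (hab : ∀ i j, ∑ k, a i k * a i k + ∑ k, a j k * a j k - 2 * ∑ k, a i k * a j k ≤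
      ∑ k, b i k * b i k + ∑ k, b j k * b j k - 2 * ∑ k, b i k * b j k)
    {M : (κ' → ℝ) → ℝ} (hM : Integrable M (gaussianPi κ')) (hbM : ∀ y i, linForms b y i ≤ M y)
    {t : ℝ} (ht : 0 ≤ t) :
    (gaussianPi κ).real {x | ∃ i, ∫ y, M y ∂(gaussianPi κ') + t ≤ linForms a x i} ≤
      Real.exp (-t ^ 2 / 2) := by
  set W := ∫ y, M y ∂(gaussianPi κ') with hW
  have hb : ∀ β : ℝ, 0 < β →
      (gaussianPi κ).real {x | ∃ i, W + t ≤ linForms a x i} ≤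
        Real.exp (-t ^ 2 / 2 + t * (β⁻¹ * Real.log (Fintype.card ι))) := by
    intro β hβ
    have hsub : {x | ∃ i, W + t ≤ linForms a x i} ⊆ {x | W + t ≤ softMax β (linForms a x)} := by
      rintro x ⟨i, hi⟩
      exact hi.trans (le_softMax hβ _ i)
    refine (measureReal_mono hsub).trans ?_
    -- Chernoff's bound at the optimal parameter `t`: `-t (W + t) + t² / 2 + t W = -t² / 2`.
    refine (measure_ge_le_exp_mul_mgf (X := fun x => softMax β (linForms a x)) (W + t) ht
      (integrable_exp_softMax_linForms a hβ t)).trans ?_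
    have h1 := integral_exp_softMax_le ha hab hβ ht
    have hi : Integrable (fun y => softMax β (linForms b y)) (gaussianPi κ') :=
      integrable_of_mem_interior_integrableExpSet
        (by rw [interior_integrableExpSet_softMax_linForms b hβ]; trivial)
    have h2 : ∫ y, softMax β (linForms b y) ∂(gaussianPi κ') ≤
        W + β⁻¹ * Real.log (Fintype.card ι) := by
      refine (integral_mono hi (hM.add (integrable_const (β⁻¹ * Real.log (Fintype.card ι))))
        fun y => softMax_le hβ (hbM y)).trans (le_of_eq ?_)
      rw [integral_add' hM (integrable_const _)]
      simp [hW]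
    refine (mul_le_mul_of_nonneg_left h1 (Real.exp_pos _).le).trans ?_
    rw [← Real.exp_add, Real.exp_le_exp]
    nlinarith [mul_le_mul_of_nonneg_left h2 ht]
  have hlim : Filter.Tendsto
      (fun β : ℝ => Real.exp (-t ^ 2 / 2 + t * (β⁻¹ * Real.log (Fintype.card ι))))
      Filter.atTop (nhds (Real.exp (-t ^ 2 / 2 + t * (0 * Real.log (Fintype.card ι))))) :=
    (Real.continuous_exp.tendsto _).comp
      (((tendsto_inv_atTop_zero.mul_const _).const_mul t).const_add _)
  rw [zero_mul, mul_zero, add_zero] at hlim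
  refine ge_of_tendsto hlim ?_
  filter_upwards [Filter.eventually_gt_atTop 0] with β hβ using hb β hβ

end

/-! ### The function `phi` and its inverse. -/

theorem phi_zero : phi 0 = 0 := by simp [phi, Real.Gamma_zero]

theorem phi_pos {t : ℝ} (ht : 0 < t) : 0 < phi t :=
  div_pos (mul_pos (by positivity) (Real.Gamma_pos_of_pos (by positivity)))
    (Real.Gamma_pos_of_pos (by positivity))

theorem phi_mul_phi_add_one {t : ℝ} (ht : 0 < t) : phi t * phi (t + 1) = t := by
  have h1 := Real.Gamma_pos_of_pos (half_pos ht)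
  have h2 := Real.Gamma_pos_of_pos (half_pos (by linarith : 0 < t + 1))
  have h3 : Real.Gamma ((t + 1 + 1) / 2) = t / 2 * Real.Gamma (t / 2) := by
    rw [← Real.Gamma_add_one (half_pos ht).ne']; congr 1; ring
  rw [phi, phi, h3]
  field_simp
  rw [Real.sq_sqrt (by norm_num)]

/-- Log-convexity of `Γ` at `(t + 1) / 2`, the midpoint of `t / 2` and `t / 2 + 1`. -/
theorem phi_sq_le {t : ℝ} (ht : 0 < t) : phi t ^ 2 ≤ t := by
  have h1 := Real.Gamma_pos_of_pos (half_pos ht)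
  have h2 := Real.Gamma_pos_of_pos (half_pos (by linarith : 0 < t + 1))
  have h3 : Real.Gamma (t / 2 + 1) = t / 2 * Real.Gamma (t / 2) :=
    Real.Gamma_add_one (half_pos ht).ne'
  have h := Real.Gamma_mul_add_mul_le_rpow_Gamma_mul_rpow_Gamma (half_pos ht)
    (by positivity : 0 < t / 2 + 1) (by norm_num : (0 : ℝ) < 1 / 2) (by norm_num : (0 : ℝ) < 1 / 2)
    (by norm_num)
  have e : 1 / 2 * (t / 2) + 1 / 2 * (t / 2 + 1) = (t + 1) / 2 := by ring
  rw [e, ← Real.sqrt_eq_rpow, ← Real.sqrt_eq_rpow] at h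
  have h4 : Real.Gamma ((t + 1) / 2) ^ 2 ≤ Real.Gamma (t / 2) * (t / 2 * Real.Gamma (t / 2)) := by
    calc _ ≤ (√(Real.Gamma (t / 2)) * √(Real.Gamma (t / 2 + 1))) ^ 2 :=
          pow_le_pow_left₀ h2.le h 2
      _ = _ := by rw [mul_pow, Real.sq_sqrt h1.le, Real.sq_sqrt (by rw [h3]; positivity), h3]
  rw [phi, div_pow, mul_pow, Real.sq_sqrt (by norm_num), div_le_iff₀ (by positivity)]
  nlinarith

/-- Equality at `t` would propagate through `phi t * phi (t + 1) = t`: it forces `phi (t + 1)² = t`,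
hence `phi (t + 2)² = (t + 1)² / t > t + 2`. The strictness is what later makes a deterministic
radius possible. -/
theorem phi_lt_sqrt {t : ℝ} (ht : 0 < t) : phi t < √t := by
  refine lt_of_le_of_ne (Real.le_sqrt_of_sq_le (phi_sq_le ht)) fun h => ?_
  have h1 := phi_mul_phi_add_one ht
  have h2 := phi_mul_phi_add_one (by linarith : 0 < t + 1)
  have h3 := phi_sq_le (by linarith : 0 < t + 1 + 1)
  have hs := Real.sq_sqrt ht.le
  have hp := phi_pos ht
  rw [← h] at hs
  have h4 : phi (t + 1) = phi t := by
    have : phi t * phi (t + 1) = phi t * phi t := by rw [h1, ← sq, hs]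
    exact mul_left_cancel₀ hp.ne' this
  rw [h4] at h2
  have h5 : (t + 1) ^ 2 = phi t ^ 2 * phi (t + 1 + 1) ^ 2 := by rw [← mul_pow, h2]
  rw [hs] at h5
  nlinarith

/-- Writing `1 / Γ(t/2)` as `(t/2) / Γ(t/2 + 1)` removes the pole at `0`. -/
theorem continuousOn_phi : ContinuousOn phi (Set.Ici 0) := by
  have hG : ∀ s : ℝ, 0 < s → ContinuousAt Real.Gamma s := fun s hs =>
    (Real.differentiableAt_Gamma fun k =>
      (show -(k : ℝ) < s from by linarith [Nat.cast_nonneg (α := ℝ) k]).ne').continuousAt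
  have h : ContinuousOn (fun t : ℝ => √2 * Real.Gamma ((t + 1) / 2) * (t / 2) /
      Real.Gamma (t / 2 + 1)) (Set.Ici 0) := by
    intro t ht
    have ht' : (0 : ℝ) ≤ t := ht
    refine ContinuousAt.continuousWithinAt (ContinuousAt.div ?_ ?_
      (Real.Gamma_pos_of_pos (by positivity)).ne')
    · refine (continuousAt_const.mul ?_).mul (by fun_prop)
      exact ContinuousAt.comp (f := fun t : ℝ => (t + 1) / 2) (hG _ (by positivity)) (by fun_prop)
    · exact ContinuousAt.comp (f := fun t : ℝ => t / 2 + 1) (hG _ (by positivity)) (by fun_prop)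
  refine h.congr fun t ht => ?_
  rcases eq_or_lt_of_le (show (0 : ℝ) ≤ t from ht) with rfl | ht
  · simp [phi_zero]
  · have h1 := Real.Gamma_pos_of_pos (half_pos ht)
    simp only [phi]
    rw [Real.Gamma_add_one (half_pos ht).ne']
    field_simp

theorem exists_phi_eq {w : ℝ} (hw : 0 ≤ w) : ∃ t ∈ Set.Ici (0 : ℝ), phi t = w := by
  -- Since `phi (T + 1) ≤ √(T + 1) ≤ w + 2`, the functional equation gives `phi T ≥ (w + 1)² / (w +
  -- 2) ≥ w`.
  set T : ℝ := (w + 1) ^ 2 with hT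
  have hT0 : 0 < T := by positivity
  have hTw : w ≤ phi T := by
    have h1 := phi_mul_phi_add_one hT0
    have h2 := phi_sq_le (by linarith : 0 < T + 1)
    have h3 := phi_pos (by linarith : 0 < T + 1)
    have h4 : phi (T + 1) ≤ w + 2 := by
      refine abs_le_of_sq_le_sq' (h2.trans ?_) (by positivity) |>.2
      nlinarith
    by_contra! h
    nlinarith [phi_pos hT0]
  have := intermediate_value_Icc hT0.le (continuousOn_phi.mono Set.Icc_subset_Ici_self)
  rw [phi_zero] at this
  obtain ⟨t, ht, h⟩ := this ⟨hw, hTw⟩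
  exact ⟨t, ht.1, h⟩

/-- `ω + η < √m₀` unless `ω + η = 0`. -/
theorem lt_sqrt_invFunOn_phi {w : ℝ} (hw : 0 < w) :
    w < √(Function.invFunOn phi (Set.Ici 0) w) := by
  -- Whichever preimage is chosen will do, so injectivity of `phi` is not needed.
  obtain ⟨h0, h1⟩ := Function.invFunOn_pos (exists_phi_eq hw.le)
  have hpos : 0 < Function.invFunOn phi (Set.Ici 0) w := by
    refine lt_of_le_of_ne h0 fun h => ?_
    rw [← h, phi_zero] at h1
    exact hw.ne h1
  conv_lhs => rw [← h1]
  exact phi_lt_sqrt hpos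

/-! ### Gaussian width and the bound for finitely many directions. -/

section
variable {m n : ℕ}

theorem sum_mul_eq_inner {ι : Type*} [Fintype ι] (x y : EuclideanSpace ℝ ι) :
    ∑ k, x k * y k = inner ℝ x y := by
  simp [PiLp.inner_apply, mul_comm]

/-- Integrate `‖x‖ ≤ ‖x‖² / (2√m) + √m / 2`, using that the mean of `‖x‖²` is `m`. -/
theorem integral_norm_stdGaussian_le (m : ℕ) :
    ∫ h, ‖h‖ ∂(stdGaussian (EuclideanSpace ℝ (Fin m))) ≤ √m := by
  have hint : ∀ k : Fin m, Integrable (fun x : Fin m → ℝ => x k * x k) (gaussianPi (Fin m)) :=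
    fun k => ((expGrowth_coord k).mul (expGrowth_coord k)).integrable (by fun_prop)
  have hsq : ∫ x, ∑ k, x k * x k ∂(gaussianPi (Fin m)) = m := by
    rw [integral_finsetSum _ fun k _ => hint k]
    have : ∀ k : Fin m, ∫ x, x k * x k ∂(gaussianPi (Fin m)) = 1 := by
      intro k
      rw [integral_coord_mul_gaussianPi k (f := fun x => x k) (f' := fun _ => 1)
        (fun x t => by simpa using hasDerivAt_id' t)
        ((expGrowth_coord k).integrable (by fun_prop)) (integrable_const _) (hint k)]
      simp
    simp [this]
  rcases Nat.eq_zero_or_pos m with rfl | hm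
  · simp [Subsingleton.elim _ (0 : EuclideanSpace ℝ (Fin 0))]
  have hm' : (0 : ℝ) < √m := Real.sqrt_pos.2 (by exact_mod_cast hm)
  have hmm : √m * √m = m := Real.mul_self_sqrt (Nat.cast_nonneg m)
  rw [← map_pi_eq_stdGaussian, integral_map (by fun_prop) (by fun_prop)]
  have hnorm : ∀ x : Fin m → ℝ, ‖WithLp.toLp 2 x‖ ^ 2 = ∑ k, x k * x k := by
    intro x
    rw [EuclideanSpace.real_norm_sq_eq]
    simp [sq]
  have hb : ∀ x : Fin m → ℝ, ‖WithLp.toLp 2 x‖ ≤ (2 * √m)⁻¹ * (∑ k, x k * x k) + √m / 2 := by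
    intro x
    rw [← hnorm]
    have : 0 ≤ (‖WithLp.toLp 2 x‖ - √m) ^ 2 := sq_nonneg _
    rw [← sub_nonneg]
    have e : (2 * √m)⁻¹ * ‖WithLp.toLp 2 x‖ ^ 2 + √m / 2 - ‖WithLp.toLp 2 x‖ =
        (2 * √m)⁻¹ * (‖WithLp.toLp 2 x‖ - √m) ^ 2 := by field_simp; ring
    rw [e]; positivity
  have hi : Integrable (fun x : Fin m → ℝ => (2 * √m)⁻¹ * (∑ k, x k * x k) + √m / 2)
      (gaussianPi (Fin m)) :=
    ((integrable_finsetSum _ fun k _ => hint k).const_mul _).add (integrable_const _)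
  refine (integral_mono_of_nonneg (ae_of_all _ fun x => norm_nonneg _) hi
    (ae_of_all _ hb)).trans (le_of_eq ?_)
  rw [integral_add ((integrable_finsetSum _ fun k _ => hint k).const_mul _) (integrable_const _),
    integral_const_mul, hsq, integral_const]
  simp only [probReal_univ, one_smul]
  field_simp
  linarith

/-- The support function of a bounded part of `C`. -/
noncomputable def supportBall (C : Set (EuclideanSpace ℝ (Fin n))) (g : EuclideanSpace ℝ (Fin n)) : ℝ :=
  sSup ((fun z => inner ℝ g z) '' (C ∩ Metric.closedBall 0 1))

theorem bddAbove_inner_image (C : Set (EuclideanSpace ℝ (Fin n))) (g : EuclideanSpace ℝ (Fin n)) :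
    BddAbove ((fun z => inner ℝ g z) '' (C ∩ Metric.closedBall 0 1)) := by
  refine ⟨‖g‖, ?_⟩
  rintro _ ⟨z, ⟨-, hz⟩, rfl⟩
  rw [mem_closedBall_zero_iff] at hz
  exact (real_inner_le_norm g z).trans (mul_le_of_le_one_right (norm_nonneg _) hz)

theorem inner_le_supportBall {C : Set (EuclideanSpace ℝ (Fin n))} {z : EuclideanSpace ℝ (Fin n)} (hz : z ∈ C) (hz1 : ‖z‖ ≤ 1) (g : EuclideanSpace ℝ (Fin n)) :
    inner ℝ g z ≤ supportBall C g :=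
  le_csSup (bddAbove_inner_image C g) ⟨z, ⟨hz, mem_closedBall_zero_iff.2 hz1⟩, rfl⟩

theorem supportBall_nonneg {C : Set (EuclideanSpace ℝ (Fin n))} (h0 : (0 : EuclideanSpace ℝ (Fin n)) ∈ C) (g : EuclideanSpace ℝ (Fin n)) : 0 ≤ supportBall C g := by
  simpa using inner_le_supportBall h0 (by simp) g

/-- A supremum of linear forms of norm at most one is 1-Lipschitz; this supplies the continuity,
hence measurability, of the integrand in the width. -/
theorem supportBall_le_add {C : Set (EuclideanSpace ℝ (Fin n))} (h0 : (0 : EuclideanSpace ℝ (Fin n)) ∈ C) (g g' : EuclideanSpace ℝ (Fin n)) :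
    supportBall C g ≤ supportBall C g' + ‖g - g'‖ := by
  refine csSup_le ⟨_, 0, ⟨h0, by simp⟩, rfl⟩ ?_
  rintro _ ⟨z, ⟨hzC, hz⟩, rfl⟩
  rw [mem_closedBall_zero_iff] at hz
  have h1 := inner_le_supportBall hzC hz g'
  have h2 := (real_inner_le_norm (g - g') z).trans
    (mul_le_of_le_one_right (norm_nonneg _) hz)
  rw [inner_sub_left] at h2
  simp only
  linarith

theorem continuous_supportBall {C : Set (EuclideanSpace ℝ (Fin n))} (h0 : (0 : EuclideanSpace ℝ (Fin n)) ∈ C) : Continuous (supportBall C) := by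
  refine (LipschitzWith.of_dist_le_mul (K := 1) fun g g' => ?_).continuous
  rw [NNReal.coe_one, one_mul, Real.dist_eq, dist_eq_norm, abs_sub_le_iff]
  exact ⟨by linarith [supportBall_le_add h0 g g'],
    by linarith [supportBall_le_add h0 g' g, norm_sub_rev g g']⟩

theorem integrable_norm_stdGaussian (m : ℕ) :
    Integrable (fun h => ‖h‖) (stdGaussian (EuclideanSpace ℝ (Fin m))) :=
  (IsGaussian.integrable_id (μ := stdGaussian (EuclideanSpace ℝ (Fin m)))).norm

theorem integrable_supportBall {C : Set (EuclideanSpace ℝ (Fin n))} (h0 : (0 : EuclideanSpace ℝ (Fin n)) ∈ C) :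
    Integrable (supportBall C) (stdGaussian (EuclideanSpace ℝ (Fin n))) := by
  refine (integrable_norm_stdGaussian n).mono'
    (continuous_supportBall h0).aestronglyMeasurable (ae_of_all _ fun g => ?_)
  rw [Real.norm_eq_abs, abs_of_nonneg (supportBall_nonneg h0 g)]
  refine csSup_le ⟨_, 0, ⟨h0, by simp⟩, rfl⟩ ?_
  rintro _ ⟨z, ⟨-, hz⟩, rfl⟩
  rw [mem_closedBall_zero_iff] at hz
  exact (real_inner_le_norm g z).trans (mul_le_of_le_one_right (norm_nonneg _) hz)

theorem gaussianWidth_nonneg {C : Set (EuclideanSpace ℝ (Fin n))} (h0 : (0 : EuclideanSpace ℝ (Fin n)) ∈ C) :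
    0 ≤ gaussianWidth (C ∩ Metric.closedBall 0 1) :=
  integral_nonneg fun g => supportBall_nonneg h0 g

theorem measurePreserving_toLp_inl {κ κ' : Type*} [Fintype κ] [Fintype κ'] :
    MeasurePreserving (fun y : κ ⊕ κ' → ℝ => WithLp.toLp 2 fun k => y (Sum.inl k))
      (gaussianPi (κ ⊕ κ')) (stdGaussian (EuclideanSpace ℝ κ)) := by
  have h1 : MeasurePreserving (WithLp.toLp 2) (gaussianPi κ) (stdGaussian (EuclideanSpace ℝ κ)) :=
    ⟨by fun_prop, map_pi_eq_stdGaussian⟩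
  exact h1.comp (measurePreserving_fst.comp
    (measurePreserving_sumPiEquivProdPi fun _ : κ ⊕ κ' => gaussianReal 0 1))

theorem measurePreserving_toLp_inr {κ κ' : Type*} [Fintype κ] [Fintype κ'] :
    MeasurePreserving (fun y : κ ⊕ κ' → ℝ => WithLp.toLp 2 fun k => y (Sum.inr k))
      (gaussianPi (κ ⊕ κ')) (stdGaussian (EuclideanSpace ℝ κ')) := by
  have h1 : MeasurePreserving (WithLp.toLp 2) (gaussianPi κ') (stdGaussian (EuclideanSpace ℝ κ')) :=
    ⟨by fun_prop, map_pi_eq_stdGaussian⟩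
  exact h1.comp (measurePreserving_snd.comp
    (measurePreserving_sumPiEquivProdPi fun _ : κ ⊕ κ' => gaussianReal 0 1))

/-- The matrix with a given family of entries. -/
def matrixOf (x : Fin m × Fin n → ℝ) : Matrix (Fin m) (Fin n) ℝ := Matrix.of fun i j => x (i, j)

theorem inner_toEuclideanLin_matrixOf (x : Fin m × Fin n → ℝ) (u : EuclideanSpace ℝ (Fin n))
    (v : EuclideanSpace ℝ (Fin m)) :
    inner ℝ (Matrix.toEuclideanLin (matrixOf x) u) v = ∑ p : Fin m × Fin n, v p.1 * u p.2 * x p := by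
  rw [← sum_mul_eq_inner, Fintype.sum_prod_type]
  refine Finset.sum_congr rfl fun i _ => ?_
  simp only [Matrix.toLpLin_apply, Matrix.mulVec, dotProduct, matrixOf, Matrix.of_apply]
  rw [Finset.sum_mul]
  exact Finset.sum_congr rfl fun j _ => by ring

/-- The finite form of the Gaussian bound for the norm of a random matrix on a set of
directions. -/
theorem measureReal_exists_le_inner {ι : Type*} [Fintype ι] [Nonempty ι] {C : Set (EuclideanSpace ℝ (Fin n))}
    (h0 : (0 : EuclideanSpace ℝ (Fin n)) ∈ C) {u : ι → EuclideanSpace ℝ (Fin n)} {v : ι → EuclideanSpace ℝ (Fin m)} (huC : ∀ i, u i ∈ C)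
    (hu : ∀ i, ‖u i‖ = 1) (hv : ∀ i, ‖v i‖ = 1) {t : ℝ} (ht : 0 ≤ t) :
    (gaussianPi (Fin m × Fin n)).real {x | ∃ i, √m + gaussianWidth (C ∩ Metric.closedBall 0 1) + t ≤
      inner ℝ (Matrix.toEuclideanLin (matrixOf x) (u i)) (v i)} ≤ Real.exp (-t ^ 2 / 2) := by
  -- Chevet's pair of processes: `⟨A u, v⟩` and `⟨h, v⟩ + ⟨g, u⟩`. For unit vectors the squared
  -- increments differ by `2 (1 - ⟨v, v'⟩)(1 - ⟨u, u'⟩) ≥ 0`, and the second process is at most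
  -- `‖h‖` plus the support function at `g`.
  set a : ι → Fin m × Fin n → ℝ := fun i p => v i p.1 * u i p.2 with ha
  set b : ι → Fin m ⊕ Fin n → ℝ := fun i => Sum.elim (v i) (u i) with hb
  have hinner : ∀ i j, ∑ k, a i k * a j k = inner ℝ (v i) (v j) * inner ℝ (u i) (u j) := by
    intro i j
    rw [← sum_mul_eq_inner, ← sum_mul_eq_inner, Finset.sum_mul_sum, Fintype.sum_prod_type]
    exact Finset.sum_congr rfl fun k _ => Finset.sum_congr rfl fun l _ => by simp only [ha]; ring
  have hinner' : ∀ i j, ∑ k, b i k * b j k = inner ℝ (v i) (v j) + inner ℝ (u i) (u j) := by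
    intro i j
    rw [← sum_mul_eq_inner, ← sum_mul_eq_inner, Fintype.sum_sum_type]
    simp [hb]
  have hle : ∀ {k : ℕ} {p q : EuclideanSpace ℝ (Fin k)}, ‖p‖ = 1 → ‖q‖ = 1 →
      |inner ℝ p q| ≤ 1 := by
    intro k p q hp hq
    simpa [hp, hq] using abs_real_inner_le_norm p q
  have hself : ∀ {k : ℕ} {p : EuclideanSpace ℝ (Fin k)}, ‖p‖ = 1 → inner ℝ p p = 1 := by
    intro k p hp
    rw [real_inner_self_eq_norm_sq, hp, one_pow]
  set M : (Fin m ⊕ Fin n → ℝ) → ℝ := fun y =>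
    ‖WithLp.toLp 2 fun k => y (Sum.inl k)‖ + supportBall C (WithLp.toLp 2 fun k => y (Sum.inr k))
    with hM
  have mp1 := measurePreserving_toLp_inl (κ := Fin m) (κ' := Fin n)
  have mp2 := measurePreserving_toLp_inr (κ := Fin m) (κ' := Fin n)
  have i1 := mp1.integrable_comp_of_integrable (integrable_norm_stdGaussian m)
  have i2 := mp2.integrable_comp_of_integrable (integrable_supportBall h0)
  have hMi : Integrable M (gaussianPi (Fin m ⊕ Fin n)) := i1.add i2
  have hMle : ∫ y, M y ∂(gaussianPi (Fin m ⊕ Fin n)) ≤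
      √m + gaussianWidth (C ∩ Metric.closedBall 0 1) := by
    have e1 : ∫ y : Fin m ⊕ Fin n → ℝ, ‖WithLp.toLp 2 fun k => y (Sum.inl k)‖
        ∂(gaussianPi (Fin m ⊕ Fin n)) = ∫ h, ‖h‖ ∂(stdGaussian (EuclideanSpace ℝ (Fin m))) := by
      rw [← mp1.map_eq, integral_map mp1.measurable.aemeasurable (by fun_prop)]
    have e2 : ∫ y : Fin m ⊕ Fin n → ℝ, supportBall C (WithLp.toLp 2 fun k => y (Sum.inr k))
        ∂(gaussianPi (Fin m ⊕ Fin n)) = gaussianWidth (C ∩ Metric.closedBall 0 1) := by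
      change _ = ∫ g, supportBall C g ∂(stdGaussian (EuclideanSpace ℝ (Fin n)))
      rw [← mp2.map_eq, integral_map mp2.measurable.aemeasurable
        (continuous_supportBall h0).aestronglyMeasurable]
    have e3 := integral_add i1 i2
    simp only [Function.comp_def] at e3
    rw [hM, e3, e1, e2]
    exact add_le_add_left (integral_norm_stdGaussian_le m) _
  have key := measureReal_exists_le_linForms (a := a) (b := b) (fun i j => ?_) (fun i j => ?_)
    hMi (fun y i => ?_) ht
  · refine (measureReal_mono ?_).trans key
    rintro x ⟨i, hi⟩
    refine ⟨i, le_trans (by linarith) (hi.trans (le_of_eq ?_))⟩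
    rw [inner_toEuclideanLin_matrixOf]
    rfl
  · rw [hinner]
    refine (le_abs_self _).trans ?_
    rw [abs_mul]
    exact mul_le_one₀ (hle (hv i) (hv j)) (abs_nonneg _) (hle (hu i) (hu j))
  · simp only [hinner, hinner', hself (hv i), hself (hv j), hself (hu i), hself (hu j)]
    have h1 := (abs_le.1 (hle (hv i) (hv j))).2
    have h2 := (abs_le.1 (hle (hu i) (hu j))).2
    nlinarith [mul_nonneg (sub_nonneg.2 h1) (sub_nonneg.2 h2)]
  · simp only [linForms, hb, hM, Fintype.sum_sum_type, Sum.elim_inl, Sum.elim_inr]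
    refine add_le_add ?_ ?_
    · have h := real_inner_le_norm (v i) (WithLp.toLp 2 fun k => y (Sum.inl k))
      rw [← sum_mul_eq_inner, hv i, one_mul] at h
      exact h
    · have h := inner_le_supportBall (huC i) (hu i).le (WithLp.toLp 2 fun k => y (Sum.inr k))
      rw [real_inner_comm, ← sum_mul_eq_inner] at h
      exact h

end

/-! ### From finitely many directions to a whole cone. -/

section
variable {m n : ℕ}

theorem continuous_inner_matrixOf (x : Fin m × Fin n → ℝ) :
    Continuous fun q : EuclideanSpace ℝ (Fin n) × EuclideanSpace ℝ (Fin m) =>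
      (inner ℝ (Matrix.toEuclideanLin (matrixOf x) q.1) q.2 : ℝ) := by
  simp only [inner_toEuclideanLin_matrixOf]
  fun_prop

/-- The set of matrices which are bounded by `K` on the unit vectors of `C`. -/
def boundedOn (m : ℕ) (C : Set (EuclideanSpace ℝ (Fin n))) (K : ℝ) : Set (Fin m × Fin n → ℝ) :=
  {x | ∀ u ∈ C, ‖u‖ = 1 → ‖Matrix.toEuclideanLin (matrixOf x) u‖ ≤ K}

theorem isClosed_boundedOn (C : Set (EuclideanSpace ℝ (Fin n))) (K : ℝ) :
    IsClosed (boundedOn m C K) := by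
  have : boundedOn m C K = ⋂ u ∈ C, ⋂ _ : ‖u‖ = 1,
      {x | ‖Matrix.toEuclideanLin (matrixOf x) u‖ ≤ K} := by
    ext x; simp [boundedOn]
  rw [this]
  refine isClosed_biInter fun u _ => isClosed_iInter fun _ => isClosed_le ?_ continuous_const
  refine Continuous.norm ?_
  simp only [Matrix.toLpLin_apply, matrixOf]
  fun_prop

/-- The norm of `A u` is attained by pairing with `A u / ‖A u‖`. A strict violation is an open
condition on the pair, so it is seen along a dense sequence of pairs, and the finite bounds do not
depend on the number of pairs. -/
theorem measureReal_compl_boundedOn_le {C : Set (EuclideanSpace ℝ (Fin n))}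
    (h0 : (0 : EuclideanSpace ℝ (Fin n)) ∈ C) {t : ℝ} (ht : 0 ≤ t) :
    (gaussianPi (Fin m × Fin n)).real
      (boundedOn m C (√m + gaussianWidth (C ∩ Metric.closedBall 0 1) + t))ᶜ ≤
      Real.exp (-t ^ 2 / 2) := by
  set K := √m + gaussianWidth (C ∩ Metric.closedBall 0 1) + t with hK
  have hK0 : 0 ≤ K := by
    have := gaussianWidth_nonneg h0
    positivity
  set Q : Set (EuclideanSpace ℝ (Fin n) × EuclideanSpace ℝ (Fin m)) :=
    {q | q.1 ∈ C ∧ ‖q.1‖ = 1 ∧ ‖q.2‖ = 1} with hQ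
  have hsub : (boundedOn m C K)ᶜ ⊆ {x | ∃ q : Q,
      K < inner ℝ (Matrix.toEuclideanLin (matrixOf x) q.1.1) q.1.2} := by
    intro x hx
    simp only [boundedOn, Set.mem_compl_iff, Set.mem_ofPred_eq, not_forall, not_le] at hx
    obtain ⟨u, huC, hu, hlt⟩ := hx
    set w := Matrix.toEuclideanLin (matrixOf x) u with hw
    have hw0 : ‖w‖ ≠ 0 := (lt_of_le_of_lt hK0 hlt).ne'
    refine ⟨⟨(u, ‖w‖⁻¹ • w), huC, hu, ?_⟩, ?_⟩
    · rw [norm_smul, norm_inv, norm_norm, inv_mul_cancel₀ hw0]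
    · simp only
      rw [real_inner_smul_right, real_inner_self_eq_norm_sq, sq, inv_mul_cancel_left₀ hw0]
      exact hlt
  refine (measureReal_mono hsub).trans ?_
  rcases isEmpty_or_nonempty Q with hQe | hQn
  · simp only [IsEmpty.exists_iff, Set.ofPred_false, measureReal_empty]
    exact (Real.exp_pos _).le
  set q := TopologicalSpace.denseSeq Q with hq
  set S : ℕ → Set (Fin m × Fin n → ℝ) := fun N => {x | ∃ i : Fin (N + 1),
      K ≤ inner ℝ (Matrix.toEuclideanLin (matrixOf x) (q i).1.1) (q i).1.2} with hS
  have hSmono : Monotone S := by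
    rintro N N' h x ⟨i, hi⟩
    exact ⟨⟨i, by omega⟩, hi⟩
  have hsub2 : {x : Fin m × Fin n → ℝ | ∃ q : Q,
      K < inner ℝ (Matrix.toEuclideanLin (matrixOf x) q.1.1) q.1.2} ⊆ ⋃ N, S N := by
    rintro x ⟨p, hp⟩
    have ho : IsOpen {p : Q | K < inner ℝ (Matrix.toEuclideanLin (matrixOf x) p.1.1) p.1.2} :=
      isOpen_lt continuous_const ((continuous_inner_matrixOf x).comp continuous_subtype_val)
    obtain ⟨N, hN⟩ := (TopologicalSpace.denseRange_denseSeq Q).exists_mem_open ho ⟨p, hp⟩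
    exact Set.mem_iUnion.2 ⟨N, ⟨N, Nat.lt_succ_self N⟩, le_of_lt hN⟩
  have hN : ∀ N, (gaussianPi (Fin m × Fin n)) (S N) ≤ ENNReal.ofReal (Real.exp (-t ^ 2 / 2)) := by
    intro N
    have := measureReal_exists_le_inner (m := m) h0 (u := fun i : Fin (N + 1) => (q i).1.1)
      (v := fun i : Fin (N + 1) => (q i).1.2) (fun i => (q i).2.1) (fun i => (q i).2.2.1)
      (fun i => (q i).2.2.2) ht
    rw [← ofReal_measureReal]
    exact ENNReal.ofReal_le_ofReal this
  refine (measureReal_mono hsub2).trans ?_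
  refine ENNReal.toReal_le_of_le_ofReal (Real.exp_pos _).le ?_
  rw [hSmono.measure_iUnion]
  exact iSup_le hN

/-- A high probability event on which a Gaussian matrix is bounded on `C`, with some slack in the
bound traded for a deterministic bound on the whole matrix. -/
theorem exists_norm_bound {C : Set (EuclideanSpace ℝ (Fin n))}
    (h0 : (0 : EuclideanSpace ℝ (Fin n)) ∈ C) {η K : ℝ} (hη : 0 ≤ η)
    (hK : √m + gaussianWidth (C ∩ Metric.closedBall 0 1) + η < K) :
    ∃ M : ℝ, 1 - Real.exp (-η ^ 2 / 2) ≤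
      (gaussianPi (Fin m × Fin n)).real (boundedOn m C K ∩ Metric.closedBall 0 M) := by
  set t := K - (√m + gaussianWidth (C ∩ Metric.closedBall 0 1)) with ht
  have htη : η < t := by linarith
  have h1 := measureReal_compl_boundedOn_le (m := m) h0 (hη.trans htη.le)
  have e : √m + gaussianWidth (C ∩ Metric.closedBall 0 1) + t = K := by rw [ht]; ring
  rw [e] at h1
  have hexp : Real.exp (-t ^ 2 / 2) < Real.exp (-η ^ 2 / 2) := by
    rw [Real.exp_lt_exp]; nlinarith
  -- As `t > η`, the event without the ball has probability strictly above the target, so a large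
  -- enough ball keeps it there.
  have hlim : Filter.Tendsto (fun N : ℕ => (gaussianPi (Fin m × Fin n)).real
      (boundedOn m C K ∩ Metric.closedBall 0 N)) Filter.atTop
      (nhds ((gaussianPi (Fin m × Fin n)).real (boundedOn m C K))) := by
    have hmono : Monotone fun N : ℕ => boundedOn m C K ∩
        Metric.closedBall (0 : Fin m × Fin n → ℝ) N := fun N N' h =>
      Set.inter_subset_inter_right _ (Metric.closedBall_subset_closedBall (by exact_mod_cast h))
    have hU : ⋃ N : ℕ, boundedOn m C K ∩ Metric.closedBall (0 : Fin m × Fin n → ℝ) N =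
        boundedOn m C K := by
      rw [← Set.inter_iUnion, Metric.iUnion_closedBall_nat, Set.inter_univ]
    have := tendsto_measure_iUnion_atTop (μ := gaussianPi (Fin m × Fin n)) hmono
    rw [hU] at this
    exact (ENNReal.tendsto_toReal (measure_ne_top _ _)).comp this
  have hgt : 1 - Real.exp (-η ^ 2 / 2) < (gaussianPi (Fin m × Fin n)).real (boundedOn m C K) := by
    rw [probReal_compl_eq_one_sub (isClosed_boundedOn C K).measurableSet] at h1
    linarith
  obtain ⟨N, hN⟩ := (hlim.eventually (lt_mem_nhds hgt)).exists
  exact ⟨N, hN.le⟩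

end

/-! ### Geometry of the descent set and one projection step. -/

section
variable {n : ℕ} {f : EuclideanSpace ℝ (Fin n) → ℝ} {x : EuclideanSpace ℝ (Fin n)}

theorem zero_mem_descentSet : (0 : EuclideanSpace ℝ (Fin n)) ∈ descentSet f x := by
  change f (x + 0) ≤ f x
  rw [add_zero]

theorem convex_descentSet (hf : ConvexOn ℝ Set.univ f) : Convex ℝ (descentSet f x) := by
  have e : descentSet f x = (fun v => x + v) ⁻¹' {v | v ∈ Set.univ ∧ f v ≤ f x} :=
    Set.ext fun v => ⟨fun hv => ⟨trivial, hv⟩, fun hv => hv.2⟩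
  rw [e]
  exact (hf.convex_le (f x)).translate_preimage_right x

theorem descentSet_subset_tangentCone : descentSet f x ⊆ tangentCone f x :=
  Set.subset_sInter fun _ hC => hC.descentSet_subset

theorem isClosed_tangentCone : IsClosed (tangentCone f x) :=
  isClosed_sInter fun _ hC => hC.isClosed

theorem smul_mem_tangentCone {t : ℝ} (ht : 0 < t) {v : EuclideanSpace ℝ (Fin n)}
    (hv : v ∈ tangentCone f x) : t • v ∈ tangentCone f x :=
  Set.mem_sInter.2 fun C hC => hC.smul_mem t ht v (Set.mem_sInter.1 hv C hC)

/-- By minimality the tangent cone lies in this closure, so each tangent direction is a limit of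
positive multiples of descent vectors. -/
theorem isDescentCone_closure_smul :
    IsDescentCone f x (closure {v | ∃ t : ℝ, 0 < t ∧ ∃ d ∈ descentSet f x, t • d = v}) where
  isClosed := isClosed_closure
  smul_mem t ht v hv := by
    have hc : Continuous fun v : EuclideanSpace ℝ (Fin n) => t • v := continuous_const_smul t
    refine map_mem_closure hc hv ?_
    rintro _ ⟨s, hs, d, hd, rfl⟩
    exact ⟨t * s, mul_pos ht hs, d, hd, mul_smul t s d⟩
  descentSet_subset d hd := subset_closure ⟨1, one_pos, d, hd, one_smul ℝ d⟩

/-- Near the origin the descent set approximates the tangent cone, uniformly in the direction. -/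
theorem exists_radius_descentSet_approx (hf : ConvexOn ℝ Set.univ f) {δ : ℝ} (hδ : 0 < δ) :
    ∃ r : ℝ, 0 < r ∧ ∀ v ∈ tangentCone f x, ‖v‖ = 1 → ∀ w : ℝ, 0 ≤ w → w ≤ r →
      ∃ d ∈ descentSet f x, ‖d - w • v‖ ≤ δ * w := by
  have hcomp : IsCompact (tangentCone f x ∩ Metric.sphere 0 1) :=
    (isCompact_sphere 0 1).inter_left isClosed_tangentCone
  suffices h : ∃ r : ℝ, 0 < r ∧ ∀ v ∈ tangentCone f x ∩ Metric.sphere 0 1, ∀ w : ℝ, 0 ≤ w → w ≤ r →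
      ∃ d ∈ descentSet f x, ‖d - w • v‖ ≤ δ * w by
    obtain ⟨r, hr, h⟩ := h
    exact ⟨r, hr, fun v hv hv1 => h v ⟨hv, by simpa using hv1⟩⟩
  refine hcomp.induction_on (p := fun s => ∃ r : ℝ, 0 < r ∧ ∀ v ∈ s, ∀ w : ℝ, 0 ≤ w → w ≤ r →
      ∃ d ∈ descentSet f x, ‖d - w • v‖ ≤ δ * w) ⟨1, one_pos, by simp⟩ ?_ ?_ ?_
  · rintro s t hst ⟨r, hr, h⟩
    exact ⟨r, hr, fun v hv => h v (hst hv)⟩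
  · rintro s t ⟨r, hr, h⟩ ⟨r', hr', h'⟩
    refine ⟨min r r', lt_min hr hr', fun v hv w hw hwr => ?_⟩
    rcases hv with hv | hv
    · exact h v hv w hw (hwr.trans (min_le_left _ _))
    · exact h' v hv w hw (hwr.trans (min_le_right _ _))
  · rintro v₀ ⟨hv₀, -⟩
    have hcl := Set.mem_sInter.1 hv₀ _ isDescentCone_closure_smul
    -- One vector `d` serves all directions within `δ / 2` of `v₀` and all lengths `w ≤ 1 / t`:
    -- convexity and `0` in the descent set make `(w t) • d` a descent vector.
    obtain ⟨_, ⟨t, ht, d, hd, rfl⟩, htd⟩ := Metric.mem_closure_iff.1 hcl (δ / 2) (half_pos hδ)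
    refine ⟨Metric.ball v₀ (δ / 2), mem_nhdsWithin_of_mem_nhds (Metric.ball_mem_nhds _ (half_pos hδ)),
      t⁻¹, inv_pos.2 ht, fun v hv w hw hwr => ⟨(w * t) • d, ?_, ?_⟩⟩
    · refine (convex_descentSet hf).smul_mem_of_zero_mem zero_mem_descentSet hd
        ⟨by positivity, ?_⟩
      calc w * t ≤ t⁻¹ * t := by gcongr
        _ = 1 := inv_mul_cancel₀ ht.ne'
    · have e : (w * t) • d - w • v = w • (t • d - v) := by rw [smul_sub, smul_smul]
      rw [e, norm_smul, Real.norm_of_nonneg hw, mul_comm]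
      refine mul_le_mul_of_nonneg_right ?_ hw
      rw [← dist_eq_norm]
      have h1 := dist_triangle (t • d) v₀ v
      rw [dist_comm] at htd
      rw [Metric.mem_ball, dist_comm] at hv
      linarith

theorem IsProj.inner_le_zero {K : Set (EuclideanSpace ℝ (Fin n))} (hK : Convex ℝ K)
    {v p : EuclideanSpace ℝ (Fin n)} (h : IsProj K v p) {q : EuclideanSpace ℝ (Fin n)}
    (hq : q ∈ K) : inner ℝ (v - p) (q - p) ≤ 0 := by
  have : Nonempty K := ⟨⟨p, h.1⟩⟩
  refine (norm_eq_iInf_iff_real_inner_le_zero hK h.1).1 (le_antisymm ?_ ?_) q hq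
  · exact le_ciInf fun w => h.2 w w.2
  · exact ciInf_le (f := fun w : K => ‖v - w‖)
      ⟨0, by rintro _ ⟨w, rfl⟩; exact norm_nonneg _⟩ ⟨p, h.1⟩

/-- Lower bound for the norm of a projection `p` of `u` onto a convex set which nearly contains a
point of length `w` in the direction `v` on which `u` attains its maximal slope `s`. -/
theorem one_sub_mul_le_norm_of_inner_le_zero {E : Type*} [NormedAddCommGroup E]
    [InnerProductSpace ℝ E] {u p d v : E} {s w δ ε : ℝ} (hε : 0 ≤ ε)
    (hδ : 0 ≤ δ) (hw : 0 < w) (hws : w ≤ s) (hv : ‖v‖ = 1) (hvu : inner ℝ u v = s)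
    (hp : inner ℝ u p ≤ s * ‖p‖) (hd : ‖d - w • v‖ ≤ δ * w)
    (hproj : inner ℝ (u - p) (d - p) ≤ 0) (hδu : 2 * δ * ‖u‖ ≤ ε ^ 2 * s) :
    (1 - ε) * w ≤ ‖p‖ := by
  by_contra! hlt
  set q := ‖p‖ with hq
  have hq0 : 0 ≤ q := norm_nonneg p
  have hsu : s ≤ ‖u‖ := by
    have := real_inner_le_norm u v
    rwa [hvu, hv, mul_one] at this
  have h1 : w * s - δ * w * ‖u‖ ≤ inner ℝ u d := by
    have h := (abs_le.1 (abs_real_inner_le_norm u (d - w • v))).1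
    rw [inner_sub_right, inner_smul_right, hvu] at h
    have := mul_le_mul_of_nonneg_left hd (norm_nonneg u)
    linarith
  have h2 : inner ℝ p d ≤ w * q + δ * w * q := by
    have h := real_inner_le_norm p (d - w • v)
    have h' := real_inner_le_norm p v
    rw [inner_sub_right, inner_smul_right] at h
    rw [hv, mul_one] at h'
    have := mul_le_mul_of_nonneg_left hd hq0
    have := mul_le_mul_of_nonneg_left h' hw.le
    linarith
  rw [inner_sub_left, inner_sub_right, inner_sub_right, real_inner_self_eq_norm_sq] at hproj
  -- For an exact cone the right side would be zero. If `q < (1 - ε) w`, the left side exceeds `ε² s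
  -- w` when `ε > 0` and is positive when `ε = 0`, while the right side is at most `2 δ w ‖u‖ ≤ ε² s
  -- w`.
  have h3 : (s - q) * (w - q) ≤ δ * w * (‖u‖ + q) := by nlinarith
  have h4 : ε * s ≤ s - q := by nlinarith
  have h5 : ε * w < w - q := by linarith
  have hs : 0 < s := hw.trans_le hws
  have hqw : q ≤ ‖u‖ := by nlinarith
  rcases eq_or_lt_of_le hε with rfl | hε
  · have h6 : δ * ‖u‖ ≤ 0 := by linarith
    have h7 : 0 < s - q := by linarith
    have h8 : 0 < (s - q) * (w - q) := mul_pos h7 (by linarith)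
    have h9 : δ * w * (‖u‖ + q) ≤ 2 * (w * (δ * ‖u‖)) := by
      nlinarith [mul_le_mul_of_nonneg_left hqw (mul_nonneg hδ hw.le)]
    nlinarith [mul_nonneg hw.le (neg_nonneg.2 h6)]
  · have h6 : ε * s * (ε * w) < (s - q) * (w - q) :=
      mul_lt_mul' h4 h5 (by positivity) (lt_of_lt_of_le (by positivity) h4)
    have h7 : δ * w * (‖u‖ + q) ≤ w * (2 * δ * ‖u‖) := by
      nlinarith [mul_le_mul_of_nonneg_left hqw (mul_nonneg hδ hw.le)]
    nlinarith [mul_le_mul_of_nonneg_left hδu hw.le]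

/-- The slope of `u` on the tangent cone is attained. -/
theorem exists_max_slope {h : EuclideanSpace ℝ (Fin n)} (hT : h ∈ tangentCone f x) (h0 : h ≠ 0)
    (u : EuclideanSpace ℝ (Fin n)) :
    ∃ v ∈ tangentCone f x, ‖v‖ = 1 ∧ ∀ p ∈ tangentCone f x,
      inner ℝ u p ≤ inner ℝ u v * ‖p‖ := by
  have hcomp : IsCompact (tangentCone f x ∩ Metric.sphere 0 1) :=
    (isCompact_sphere 0 1).inter_left isClosed_tangentCone
  have hnorm : ∀ p ∈ tangentCone f x, p ≠ 0 → ‖p‖⁻¹ • p ∈ tangentCone f x ∩ Metric.sphere 0 1 := by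
    intro p hp hp0
    have : 0 < ‖p‖ := norm_pos_iff.2 hp0
    refine ⟨smul_mem_tangentCone (inv_pos.2 this) hp, ?_⟩
    rw [mem_sphere_zero_iff_norm, norm_smul, norm_inv, norm_norm, inv_mul_cancel₀ this.ne']
  obtain ⟨v, ⟨hv, hv1⟩, hmax⟩ := hcomp.exists_isMaxOn ⟨_, hnorm h hT h0⟩
    (f := fun v => (inner ℝ u v : ℝ)) (by fun_prop)
  refine ⟨v, hv, by simpa using hv1, fun p hp => ?_⟩
  rcases eq_or_ne p 0 with rfl | hp0
  · simp
  · have h := hmax (hnorm p hp hp0)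
    have hpos : 0 < ‖p‖ := norm_pos_iff.2 hp0
    simp only [Set.mem_ofPred_eq, inner_smul_right] at h
    rwa [inv_mul_le_iff₀ hpos, mul_comm] at h

/-- One step of projected gradient descent near `x`. -/
theorem one_sub_mul_min_le_norm (hf : ConvexOn ℝ Set.univ f) {ρ B ε δ r : ℝ} (hρ : 0 < ρ)
    (hρ1 : ρ ≤ 1) (hε : 0 ≤ ε) (hε1 : ε ≤ 1) (hδ : 0 ≤ δ) (hr : 0 < r)
    (hδB : 2 * δ * B ≤ ε ^ 2 * ρ)
    (happrox : ∀ v ∈ tangentCone f x, ‖v‖ = 1 → ∀ w : ℝ, 0 ≤ w → w ≤ r →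
      ∃ d ∈ descentSet f x, ‖d - w • v‖ ≤ δ * w)
    {h u p : EuclideanSpace ℝ (Fin n)} (hT : h ∈ tangentCone f x)
    (hu : ρ * ‖h‖ ^ 2 ≤ inner ℝ u h) (huB : ‖u‖ ≤ B * ‖h‖) (hp : IsProj (descentSet f x) u p) :
    (1 - ε) * ρ * min ‖h‖ r ≤ ‖p‖ := by
  rcases eq_or_ne h 0 with rfl | h0
  · rw [norm_zero, min_eq_left hr.le, mul_zero]
    exact norm_nonneg p
  have hh : 0 < ‖h‖ := norm_pos_iff.2 h0
  obtain ⟨v, hvT, hv1, hmax⟩ := exists_max_slope hT h0 u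
  set s : ℝ := inner ℝ u v with hs
  have hsρ : ρ * ‖h‖ ≤ s := by
    have h1 := hu.trans (hmax h hT)
    rw [sq, ← mul_assoc] at h1
    exact le_of_mul_le_mul_right h1 hh
  have hs0 : 0 < s := (mul_pos hρ hh).trans_le hsρ
  -- The ideal length is the slope `s`, capped at `r` because the approximation of the tangent cone
  -- is only available up to that length.
  have hw : 0 < min s r := lt_min hs0 hr
  obtain ⟨d, hd, hdv⟩ := happrox v hvT hv1 (min s r) hw.le (min_le_right _ _)
  have key := one_sub_mul_le_norm_of_inner_le_zero hε hδ hw (min_le_left _ _) hv1 rfl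
    (hmax p (descentSet_subset_tangentCone hp.1)) hdv
    (hp.inner_le_zero (convex_descentSet hf) hd) (by
      have h1 := mul_le_mul_of_nonneg_left huB (by positivity : 0 ≤ 2 * δ)
      have h2 := mul_le_mul_of_nonneg_right hδB hh.le
      have h3 := mul_le_mul_of_nonneg_left hsρ (sq_nonneg ε)
      linarith)
  refine le_trans ?_ key
  rw [mul_assoc]
  refine mul_le_mul_of_nonneg_left ?_ (by linarith)
  refine le_min ((mul_le_mul_of_nonneg_left (min_le_left _ _) hρ.le).trans hsρ) ?_
  exact (mul_le_mul_of_nonneg_left (min_le_right _ _) hρ.le).trans (mul_le_of_le_one_left hr.le hρ1)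

end

/-! ### Iteration on the good event. -/

section
variable {m n : ℕ}

theorem inner_toEuclideanLin_transpose (A : Matrix (Fin m) (Fin n) ℝ)
    (w : EuclideanSpace ℝ (Fin m)) (h : EuclideanSpace ℝ (Fin n)) :
    inner ℝ (Matrix.toEuclideanLin A.transpose w) h = inner ℝ w (Matrix.toEuclideanLin A h) := by
  rw [← Matrix.conjTranspose_eq_transpose_of_trivial,
    Matrix.toEuclideanLin_conjTranspose_eq_adjoint, LinearMap.adjoint_inner_left]

/-- The maps `AᵀA` are uniformly bounded for bounded matrices `A`. -/
theorem exists_norm_transpose_mul_le (m n : ℕ) (M : ℝ) :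
    ∃ L : ℝ, 0 ≤ L ∧ ∀ x ∈ Metric.closedBall (0 : Fin m × Fin n → ℝ) M,
      ∀ h : EuclideanSpace ℝ (Fin n), ‖Matrix.toEuclideanLin (matrixOf x).transpose
        (Matrix.toEuclideanLin (matrixOf x) h)‖ ≤ L * ‖h‖ := by
  have hcomp : IsCompact (Metric.closedBall (0 : Fin m × Fin n → ℝ) M ×ˢ
      Metric.sphere (0 : EuclideanSpace ℝ (Fin n)) 1) :=
    (isCompact_closedBall _ _).prod (isCompact_sphere _ _)
  have hcont : Continuous fun q : (Fin m × Fin n → ℝ) × EuclideanSpace ℝ (Fin n) =>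
      Matrix.toEuclideanLin (matrixOf q.1).transpose (Matrix.toEuclideanLin (matrixOf q.1) q.2) := by
    have : Continuous fun q : (Fin m × Fin n → ℝ) × EuclideanSpace ℝ (Fin n) => matrixOf q.1 := by
      unfold matrixOf
      fun_prop
    simp only [Matrix.toLpLin_apply]
    fun_prop
  obtain ⟨L, hL⟩ := hcomp.exists_bound_of_continuousOn hcont.continuousOn
  refine ⟨max L 0, le_max_right _ _, fun x hx h => ?_⟩
  rcases eq_or_ne h 0 with rfl | h0
  · simp
  · have hpos : 0 < ‖h‖ := norm_pos_iff.2 h0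
    have h1 := hL (x, ‖h‖⁻¹ • h) ⟨hx, by
      rw [mem_sphere_zero_iff_norm, norm_smul, norm_inv, norm_norm, inv_mul_cancel₀ hpos.ne']⟩
    simp only [map_smul, norm_smul, norm_inv, norm_norm] at h1
    rw [inv_mul_le_iff₀ hpos, mul_comm] at h1
    exact h1.trans (mul_le_mul_of_nonneg_right (le_max_left _ _) hpos.le)

end

section
variable {m n : ℕ}

theorem IsGaussianMap.aemeasurable_and_map_eq {Ω : Type*} [MeasurableSpace Ω] {P : Measure Ω}
    [IsProbabilityMeasure P] {A : Ω → Matrix (Fin m) (Fin n) ℝ} (hA : IsGaussianMap A P) :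
    AEMeasurable (fun ω (p : Fin m × Fin n) => A ω p.1 p.2) P ∧
      P.map (fun ω (p : Fin m × Fin n) => A ω p.1 p.2) = gaussianPi (Fin m × Fin n) := by
  have hm : ∀ p : Fin m × Fin n, AEMeasurable (fun ω => A ω p.1 p.2) P :=
    fun p => (hA.hasLaw p.1 p.2).aemeasurable
  refine ⟨aemeasurable_pi_lambda _ hm, ?_⟩
  rw [(iIndepFun_iff_map_fun_eq_pi_map hm).1 hA.indep]
  congr 1
  ext1 p
  exact (hA.hasLaw p.1 p.2).map_eq

/-- A closed set of matrices gives an event with the same Gaussian probability. -/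
theorem IsGaussianMap.exists_event {Ω : Type*} [MeasurableSpace Ω] {P : Measure Ω}
    [IsProbabilityMeasure P] {A : Ω → Matrix (Fin m) (Fin n) ℝ} (hA : IsGaussianMap A P)
    {G : Set (Fin m × Fin n → ℝ)} (hG : MeasurableSet G) :
    ∃ E : Set Ω, MeasurableSet E ∧ P.real E = (gaussianPi (Fin m × Fin n)).real G ∧
      ∀ ω ∈ E, (fun p : Fin m × Fin n => A ω p.1 p.2) ∈ G := by
  obtain ⟨hm, hmap⟩ := hA.aemeasurable_and_map_eq
  -- `A` is only almost everywhere measurable, so the preimage is replaced by a measurable subset of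
  -- the same probability.
  obtain ⟨E, hE, hEm, hEae⟩ := (hm.nullMeasurableSet_preimage hG).exists_measurable_subset_ae_eq
  refine ⟨E, hEm, ?_, fun ω hω => hE hω⟩
  rw [measureReal_congr hEae, ← hmap, measureReal_def, measureReal_def,
    Measure.map_apply_of_aemeasurable hm hG]

variable {f : EuclideanSpace ℝ (Fin n) → ℝ} {x : EuclideanSpace ℝ (Fin n)}

theorem IsPGD.isProj_descentSet {A : Matrix (Fin m) (Fin n) ℝ} {μ : ℝ}
    {z : ℕ → EuclideanSpace ℝ (Fin n)}
    (hz : IsPGD {v | f v ≤ f x} A (Matrix.toEuclideanLin A x) μ z) (τ : ℕ) :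
    IsProj (descentSet f x) (z τ - x - μ • Matrix.toEuclideanLin A.transpose
      (Matrix.toEuclideanLin A (z τ - x))) (z (τ + 1) - x) := by
  obtain ⟨h1, h2⟩ := hz τ
  have e : ∀ q : EuclideanSpace ℝ (Fin n), z τ - x - μ • Matrix.toEuclideanLin A.transpose
      (Matrix.toEuclideanLin A (z τ - x)) - (q - x) = z τ + μ • Matrix.toEuclideanLin A.transpose
      (Matrix.toEuclideanLin A x - Matrix.toEuclideanLin A (z τ)) - q := by
    intro q
    simp only [map_sub, smul_sub]
    abel
  refine ⟨?_, fun q hq => ?_⟩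
  · change f (x + (z (τ + 1) - x)) ≤ f x
    rw [add_sub_cancel]
    exact h1
  · have h := h2 (x + q) hq
    rw [← e, ← e, add_sub_cancel_left] at h
    exact h

/-- Deterministic lower bound for projected gradient descent started close to `x`. -/
theorem exists_radius_pow_mul_le (hf : ConvexOn ℝ Set.univ f) {μ κ ε : ℝ} (M : ℝ) (hμ : 0 < μ)
    (hκ : 0 < 1 - μ * κ ^ 2) (hε : 0 < ε) (hε1 : ε ≤ 1) :
    ∃ r : ℝ, 0 < r ∧ ∀ A : Matrix (Fin m) (Fin n) ℝ,
      (fun p : Fin m × Fin n => A p.1 p.2) ∈ boundedOn m (tangentCone f x) κ ∩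
        Metric.closedBall 0 M →
      ∀ z : ℕ → EuclideanSpace ℝ (Fin n),
        IsPGD {v | f v ≤ f x} A (Matrix.toEuclideanLin A x) μ z →
        z 0 - x ∈ tangentCone f x → ‖z 0 - x‖ ≤ r →
        ∀ τ : ℕ, ((1 - ε) * (1 - μ * κ ^ 2)) ^ τ * ‖z 0 - x‖ ≤ ‖z τ - x‖ := by
  obtain ⟨L, hL0, hL⟩ := exists_norm_transpose_mul_le m n M
  set ρ := 1 - μ * κ ^ 2 with hρ
  have hρ1 : ρ ≤ 1 := by
    have : 0 ≤ μ * κ ^ 2 := by positivity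
    linarith
  set B := 1 + μ * L with hB
  have hB0 : 0 < B := by positivity
  -- `B` bounds `‖u‖ / ‖h‖` for every matrix in the ball, and `δ` makes `2 δ B = ε² ρ`; hence `r`
  -- does not depend on `A`.
  set δ := ε ^ 2 * ρ / (2 * B) with hδ
  have hδ0 : 0 < δ := by positivity
  obtain ⟨r, hr, happrox⟩ := exists_radius_descentSet_approx (x := x) hf hδ0
  refine ⟨r, hr, fun A hA z hz hz0 hzr => ?_⟩
  obtain ⟨hAκ, hAM⟩ := hA
  have hstep : ∀ τ, z τ - x ∈ tangentCone f x →
      (1 - ε) * ρ * min ‖z τ - x‖ r ≤ ‖z (τ + 1) - x‖ := by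
    intro τ hτ
    set h := z τ - x with hh
    refine one_sub_mul_min_le_norm hf hκ hρ1 hε.le hε1 hδ0.le hr ?_ happrox hτ ?_ ?_
      (hz.isProj_descentSet τ) (B := B)
    · rw [hδ]
      apply le_of_eq
      field_simp
    · rw [inner_sub_left, real_inner_smul_left, inner_toEuclideanLin_transpose,
        real_inner_self_eq_norm_sq, real_inner_self_eq_norm_sq]
      have hA1 : ‖Matrix.toEuclideanLin A h‖ ≤ κ * ‖h‖ := by
        rcases eq_or_ne h 0 with h0 | h0
        · simp [h0]
        · have hpos : 0 < ‖h‖ := norm_pos_iff.2 h0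
          have h1 := hAκ (‖h‖⁻¹ • h) (smul_mem_tangentCone (inv_pos.2 hpos) hτ)
            (by rw [norm_smul, norm_inv, norm_norm, inv_mul_cancel₀ hpos.ne'])
          rw [map_smul, norm_smul, norm_inv, norm_norm, inv_mul_le_iff₀ hpos, mul_comm] at h1
          exact h1
      have h2 := mul_le_mul_of_nonneg_left (pow_le_pow_left₀ (norm_nonneg _) hA1 2) hμ.le
      rw [mul_pow] at h2
      rw [hρ]
      linarith
    · refine (norm_sub_le _ _).trans ?_
      rw [norm_smul, Real.norm_of_nonneg hμ.le, hB, add_mul, one_mul, mul_assoc]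
      gcongr
      exact hL _ hAM h
  have hT : ∀ τ, z τ - x ∈ tangentCone f x := by
    intro τ
    cases τ with
    | zero => exact hz0
    | succ τ => exact descentSet_subset_tangentCone (hz.isProj_descentSet τ).1
  have hc0 : 0 ≤ (1 - ε) * ρ := mul_nonneg (by linarith) hκ.le
  have hc1 : (1 - ε) * ρ ≤ 1 := mul_le_one₀ (by linarith) hκ.le hρ1
  intro τ
  induction τ with
  | zero => simp
  | succ τ ih =>
    refine le_trans ?_ (hstep τ (hT τ))
    rw [pow_succ', mul_assoc]
    -- Iterates may leave the ball of radius `r`; the cap is harmless because the claimed lower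
    -- bound never exceeds `‖z 0 - x‖ ≤ r`.
    refine mul_le_mul_of_nonneg_left (le_min ih ?_) hc0
    exact (mul_le_of_le_one_left (norm_nonneg _) (pow_le_one₀ hc0 hc1)).trans hzr

/-- The contraction factor for step sizes of order `1 / n`. -/
theorem max_sub_mul_le {μ c b : ℝ} (hμ : 0 < μ) (hb : b ≤ m) (hμc : μ ≤ c / n) :
    max (1 - 4 * c * ((m : ℝ) / n)) 0 ≤ max (1 - μ * (√(m : ℝ) + √b) ^ 2) 0 := by
  refine max_le_max_right _ ?_
  have h1 : (√(m : ℝ) + √b) ^ 2 ≤ 4 * m := by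
    have h := Real.sqrt_le_sqrt hb
    calc (√(m : ℝ) + √b) ^ 2 ≤ (√m + √m) ^ 2 := by gcongr
      _ = 4 * √m ^ 2 := by ring
      _ = 4 * m := by rw [Real.sq_sqrt (Nat.cast_nonneg m)]
  have h2 : μ * (√(m : ℝ) + √b) ^ 2 ≤ c / n * (4 * m) :=
    mul_le_mul hμc h1 (sq_nonneg _) (hμ.le.trans hμc)
  have e : 4 * c * ((m : ℝ) / n) = c / n * (4 * m) := by ring
  rw [e]
  linarith

end

end PGD

/-! ### The main theorem. -/

theorem theorem5 {m n : ℕ} (f : EuclideanSpace ℝ (Fin n) → ℝ) (hf : ConvexOn ℝ Set.univ f)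
    (x : EuclideanSpace ℝ (Fin n))
    (C : Set (EuclideanSpace ℝ (Fin n))) (hC : PGD.IsDescentCone f x C)
    (η : ℝ) (hη : 0 ≤ η) (μ : ℝ) (hμ : 0 < μ) (ε : ℝ) (hε : 0 < ε) (hε1 : ε ≤ 1) :
    ∃ r : ℝ, 0 < r ∧
      ∀ {Ω : Type*} [MeasurableSpace Ω] (P : Measure Ω) [IsProbabilityMeasure P]
        (A : Ω → Matrix (Fin m) (Fin n) ℝ), PGD.IsGaussianMap A P →
        ∃ E : Set Ω, MeasurableSet E ∧ 1 - Real.exp (-η ^ 2 / 2) ≤ P.real E ∧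
          ∀ ω ∈ E, ∀ z : ℕ → EuclideanSpace ℝ (Fin n),
            PGD.IsPGD {v | f v ≤ f x} (A ω) (Matrix.toEuclideanLin (A ω) x) μ z →
            z 0 - x ∈ PGD.tangentCone f x → ‖z 0 - x‖ ≤ r →
            ∀ τ : ℕ,
              (1 - ε) ^ τ * max (1 - μ * (√m + √(PGD.phaseTransition C η)) ^ 2) 0 ^ τ * ‖z 0 - x‖
                ≤ ‖z τ - x‖ ∧
              ∀ c : ℝ, PGD.phaseTransition C η ≤ m → μ ≤ c / n →
                (1 - ε) ^ τ * max (1 - 4 * c * (m / n)) 0 ^ τ * ‖z 0 - x‖ ≤ ‖z τ - x‖ := by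
  have h0 : (0 : EuclideanSpace ℝ (Fin n)) ∈ C := hC.descentSet_subset PGD.zero_mem_descentSet
  have hω : 0 ≤ PGD.gaussianWidth (C ∩ Metric.closedBall 0 1) := PGD.gaussianWidth_nonneg h0
  set m₀ := PGD.phaseTransition C η with hm₀
  have hε' : 0 ≤ 1 - ε := by linarith
  have reduce : ∀ (z : ℕ → EuclideanSpace ℝ (Fin n)) (τ : ℕ),
      (1 - ε) ^ τ * max (1 - μ * (√m + √m₀) ^ 2) 0 ^ τ * ‖z 0 - x‖ ≤ ‖z τ - x‖ →
      (1 - ε) ^ τ * max (1 - μ * (√m + √m₀) ^ 2) 0 ^ τ * ‖z 0 - x‖ ≤ ‖z τ - x‖ ∧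
        ∀ c : ℝ, m₀ ≤ m → μ ≤ c / n →
          (1 - ε) ^ τ * max (1 - 4 * c * (m / n)) 0 ^ τ * ‖z 0 - x‖ ≤ ‖z τ - x‖ := by
    refine fun z τ h => ⟨h, fun c hm hc => le_trans ?_ h⟩
    have := PGD.max_sub_mul_le hμ hm hc
    gcongr
  rcases eq_or_lt_of_le hη with rfl | hη
  -- For `η = 0` the required probability is `0`, so the empty event suffices. This matters because
  -- the strict slack may fail when `ω + η = 0`.
  · exact ⟨1, one_pos, fun P _ A _ => ⟨∅, MeasurableSet.empty, by simp, by simp⟩⟩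
  rcases le_or_gt (1 - μ * (√m + √m₀) ^ 2) 0 with hρ | hρ
  · refine ⟨1, one_pos, fun P _ A _ => ⟨Set.univ, MeasurableSet.univ, ?_, ?_⟩⟩
    · simpa using (Real.exp_pos _).le
    · refine fun ω _ z _ _ _ τ => reduce z τ ?_
      rw [max_eq_right hρ]
      rcases Nat.eq_zero_or_pos τ with rfl | hτ
      · simp
      · simp [zero_pow hτ.ne']
  have hslack : √m + PGD.gaussianWidth (C ∩ Metric.closedBall 0 1) + η < √m + √m₀ := by
    have := PGD.lt_sqrt_invFunOn_phi (add_pos_of_nonneg_of_pos hω hη)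
    rw [add_assoc]
    exact add_lt_add_right this _
  obtain ⟨M, hM⟩ := PGD.exists_norm_bound h0 hη.le hslack
  obtain ⟨r, hr, hrad⟩ := PGD.exists_radius_pow_mul_le (m := m) (x := x) hf M hμ hρ hε hε1
  refine ⟨r, hr, fun P _ A hA => ?_⟩
  obtain ⟨E, hE, hPE, hEG⟩ := hA.exists_event
    ((PGD.isClosed_boundedOn C (√m + √m₀)).inter Metric.isClosed_closedBall).measurableSet
  refine ⟨E, hE, hPE ▸ hM, fun ω hω z hz hz0 hzr τ => reduce z τ ?_⟩
  rw [max_eq_left hρ.le, ← mul_pow]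
  -- The bound holds on all of `C`, and the iteration needs it only on the smaller tangent cone.
  exact hrad (A ω) ⟨fun u hu => (hEG ω hω).1 u (Set.mem_sInter.1 hu C hC), (hEG ω hω).2⟩ z hz hz0
    hzr τ
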